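/- **Theorem 1.** *Notation.* For $1\le s<\infty$ let $\|f\|_s=\bigl(\int_0^{2\pi}|f(t)|^s\,dt\bigr)^{1/s}$ for $2\pi$-periodic measurable $f$, let $\|f\|_\infty=\operatorname{ess\,sup}_t|f(t)|$, and let $\hat f(k)=\frac1{2\pi}\int_{-\pi}^{\pi}f(t)e^{-ikt}\,dt$. Let $\mathfrak M$ be the set of positive, continuous, convex functions $\psi$ on $[1,\infty)$ with $\lim_{t\to\infty}\psi(t)=0$. For $\psi\in\mathfrak M$ put $$\alpha(\psi;t)=\frac{\psi(t)}{t\,|\psi'(t)|},\qquad \psi'(t):=\psi'(t+0),\qquad \underline{\alpha}_1(\psi)=\inf_{t\ge1}\alpha(\psi;t),$$ where $\alpha(\psi;1):=0$ if $\psi'(1+0)=-\infty$, and let $\mathfrak M_0=\{\psi\in\mathfrak M:\ \exists K>0\ \ \forall t\ge1\ \ \alpha(\psi;t)\ge K\}$. For $\psi\in\mathfrak M$, $\beta\in\mathbb R$ and $1\le p<\infty$, let $L^\psi_{\beta,p}$ be the set of real-valued $2\pi$-periodic functions $f$, integrable over a period, for which there is a real-valued $2\pi$-periodic function $\varphi$,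 integrable over a period, with $\|\varphi\|_p\le1$, whose Fourier series is $$\sum_{k\in\mathbb Z\setminus\{0\}}\frac{\hat f(k)}{\psi(|k|)}\,e^{i(kx+\frac{\beta\pi}2\operatorname{sign}k)} .$$ For $m\in\mathbb N$ let $$e^\perp_m(L^\psi_{\beta,p})_\infty=\sup_{f\in L^\psi_{\beta,p}}\ \inf_{\gamma_m}\ \Bigl\|f(x)-\sum_{k\in\gamma_m}\hat f(k)e^{ikx}\Bigr\|_\infty ,$$ where the infimum is over all sets $\gamma_m$ of $m$ integers. For $1<s<\infty$ let $$\xi(s)=\max\Bigl\{4\Bigl(\frac{\pi}{s-1}\Bigr)^{1/s},\ 14(8\pi)^{1/s}s\Bigr\}.$$ *Statement.* Let $1<p<\infty$, $\frac1p+\frac1{p'}=1$, let $\psi\in\mathfrak M$ satisfy $\sum_{k=1}^\infty\psi^{p'}(k)k^{p'-2}<\infty$, and let the function $g_p(t)=\psi(t)t^{1/p}$ satisfy $g_p\in\mathfrak M_0$ and $\underline{\alpha}_1(g_p)>p'$. Then for all $n\in\mathbb N$, $n\ge1$, and all $\beta\in\mathbb R$, $$K^{(1)}_{\psi,p}\Bigl(\sum_{k=n}^\infty\psi^{p'}(k)k^{p'-2}\Bigr)^{1/p'}\le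 e^\perp_{2n}(L^\psi_{\beta,p})_\infty\le e^\perp_{2n-1}(L^\psi_{\beta,p})_\infty\le K^{(2)}_{\psi,p}\Bigl(\sum_{k=n}^\infty\psi^{p'}(k)k^{p'-2}\Bigr)^{1/p'},$$ where $$K^{(1)}_{\psi,p}=\frac1{3\xi(p)}\Bigl(\frac{\underline{\alpha}_1(g_p)}{p'+\underline{\alpha}_1(g_p)}\Bigr)^{1/p}\Bigl(1-\frac{p'}{\underline{\alpha}_1(g_p)}\Bigr),\qquad K^{(2)}_{\psi,p}=\frac1\pi\,\xi(p')\Bigl(\frac{p'+\underline{\alpha}_1(g_p)}{\underline{\alpha}_1(g_p)}\Bigr)^{1/p'} .$$ -/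

import Mathlib

open Real Set Filter Topology MeasureTheory
open scoped ENNReal

namespace OrthTrig

noncomputable section

instance fact_two_pi_pos : Fact ((0 : ℝ) < 2 * π) := ⟨Real.two_pi_pos⟩

/-- The circle `ℝ / 2πℤ`: functions on it are the `2π`-periodic functions on `ℝ`.
Its `volume` has total mass `2π`, i.e. it is Lebesgue measure on `[0, 2π)`. -/
abbrev Circ : Type := AddCircle (2 * π)

/-- The Fourier coefficient `(1 / 2π) ∫_{-π}^{π} f(t) e^{-ikt} dt` of a real function. -/
def coeff (f : Circ → ℝ) (k : ℤ) : ℂ := fourierCoeff (fun t => (f t : ℂ)) k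

/-- `φ` is a `(ψ, β)`-derivative of `f`: it is summable and its Fourier series is
`∑_{k ≠ 0} (f̂(k) / ψ(|k|)) e^{i (k x + (βπ/2) sign k)}`. -/
def IsPsiBetaDeriv (ψ : ℝ → ℝ) (β : ℝ) (f φ : Circ → ℝ) : Prop :=
  Integrable φ ∧ coeff φ 0 = 0 ∧
    ∀ k : ℤ, k ≠ 0 →
      coeff φ k = coeff f k / (ψ |(k : ℝ)| : ℂ) *
        Complex.exp (Complex.I * (β * π / 2 * (k.sign : ℝ) : ℝ))

/-- The class `L^ψ_{β,p}`: summable real `2π`-periodic functions with a `(ψ, β)`-derivative in the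
unit ball of `L_p`. -/
def psiClass (ψ : ℝ → ℝ) (β : ℝ) (p : ℝ≥0∞) : Set (Circ → ℝ) :=
  {f | Integrable f ∧ ∃ φ : Circ → ℝ, IsPsiBetaDeriv ψ β f φ ∧ eLpNorm φ p volume ≤ 1}

/-- `S_γ(f; x) = ∑_{k ∈ γ} f̂(k) e^{ikx}`. -/
def partialSum (f : Circ → ℝ) (γ : Finset ℤ) (x : Circ) : ℂ :=
  ∑ k ∈ γ, coeff f k * fourier k x

/-- `e^⊥_m(f)_s`, the infimum of `‖f - S_γ(f)‖_s` over all sets `γ` of `m` integers. -/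
def bestOrth (m : ℕ) (s : ℝ≥0∞) (f : Circ → ℝ) : ℝ≥0∞ :=
  ⨅ (γ : Finset ℤ) (_ : γ.card = m),
    eLpNorm (fun x => (f x : ℂ) - partialSum f γ x) s volume

/-- `e^⊥_m(F)_s = sup_{f ∈ F} e^⊥_m(f)_s` for a class of functions `F`. -/
def bestOrthClass (m : ℕ) (s : ℝ≥0∞) (F : Set (Circ → ℝ)) : ℝ≥0∞ :=
  ⨆ f ∈ F, bestOrth m s f

/-- The set `𝔐` of positive, continuous, convex functions on `[1, ∞)` that tend to zero
(values outside `[1, ∞)` play no role). -/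
def ClassM (ψ : ℝ → ℝ) : Prop :=
  (∀ t ∈ Ici (1 : ℝ), 0 < ψ t) ∧ ContinuousOn ψ (Ici 1) ∧ ConvexOn ℝ (Ici 1) ψ ∧
    Tendsto ψ atTop (𝓝 0)

/-- `α(ψ; t) = ψ(t) / (t |ψ'(t + 0)|)`, with the right derivative. For `ψ ∈ 𝔐` the right derivative
is negative and finite at every `t > 1`; at `t = 1` it may be `-∞`, and then the value here is `0`,
which is also the usual value of the quotient. -/
def alpha (ψ : ℝ → ℝ) (t : ℝ) : ℝ := ψ t / (t * |derivWithin ψ (Ioi t) t|)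

/-- The set `𝔐₀` of functions in `𝔐` with `α(ψ; ·)` bounded below by a positive constant. -/
def ClassM0 (ψ : ℝ → ℝ) : Prop :=
  ClassM ψ ∧ ∃ K > 0, ∀ t ∈ Ici (1 : ℝ), K ≤ alpha ψ t

/-- `inf_{t ≥ n} α(ψ; t)`. -/
def lowerAlpha (ψ : ℝ → ℝ) (n : ℕ) : ℝ := sInf (alpha ψ '' Ici (n : ℝ))

/-- `g_p(t) = ψ(t) t^{1/p}`. -/
def gFun (ψ : ℝ → ℝ) (p : ℝ) (t : ℝ) : ℝ := ψ t * t ^ (1 / p)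

/-- `ξ(s) = max {4 (π / (s - 1))^{1/s}, 14 (8π)^{1/s} s}`. -/
def xi (s : ℝ) : ℝ := max (4 * (π / (s - 1)) ^ (1 / s)) (14 * (8 * π) ^ (1 / s) * s)

/-- The constant of the lower bound; `q` is the exponent conjugate to `p`. -/
def constLower (ψ : ℝ → ℝ) (p q : ℝ) : ℝ :=
  1 / (3 * xi p) * (lowerAlpha (gFun ψ p) 1 / (q + lowerAlpha (gFun ψ p) 1)) ^ (1 / p) *
    (1 - q / lowerAlpha (gFun ψ p) 1)

/-- The constant of the upper bound; `q` is the exponent conjugate to `p`. -/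
def constUpper (ψ : ℝ → ℝ) (p q : ℝ) : ℝ :=
  1 / π * xi q * ((q + lowerAlpha (gFun ψ p) 1) / lowerAlpha (gFun ψ p) 1) ^ (1 / q)

/-- The term `ψ^q(k) k^{q-2}`. -/
def term (ψ : ℝ → ℝ) (q : ℝ) (k : ℕ) : ℝ := ψ k ^ q * (k : ℝ) ^ (q - 2)

/-- `∑_{k ≥ n} ψ^q(k) k^{q-2}`. -/
def tailSum (ψ : ℝ → ℝ) (q : ℝ) (n : ℕ) : ℝ := ∑' j : ℕ, term ψ q (n + j)

end

end OrthTrig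

/-!
Everything rests on a Hardy–Littlewood inequality, `integral_norm_sum_exp_rpow_le`: if `a_k ≥ 0` is
nonincreasing for `k ≥ n`, then
`∫ |∑_{k=n}^{M} a_k e^{ikt}|^s dt ≤ C₁ a_n^s n^{s-1} + C₂ ∑_{k=n}^{M} a_k^s k^{s-2}`,
where `C₁ = 4^s π / (s - 1)` and `C₂ = 14^s 8π s^s` are the two quantities whose maximum is `ξ(s)^s`.
For `t > 1 / n` the sum is at most `a_n π / t` by summation by parts, which gives the first term. For
`1 / (N + 1) < t ≤ 1 / N` the frequencies up to `N` are bounded trivially and the others by summation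
by parts, and Hardy's inequality for the partial sums gives the second term.

The hypothesis on `g = g_p` disposes of the first term. One has `ψ^q(k) k^{q-2} = g(k)^q / k`, and
convexity together with `α(g; k) ≥ α := inf α(g; ·)` yields `g(k + 1) ≥ g(k) (1 - 1 / (α k))`.
Bernoulli's inequality turns this into `g(k)^q - g(k + 1)^q ≤ (q / α) g(k)^q / k`, and telescoping
gives `g(n)^q ≤ (q / α) T_n`, where `T_n` is the tail sum.

*Upper bound.* Remove the frequencies `|k| < n`. Differences of partial sums of `f` are convolutions
of `φ` with finite kernels `∑ ψ(k) e^{ikt}`, whose `L_q` norm is bounded by the inequality above with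
`a_k = ψ(k)`, so Hölder's inequality applies. As `T_n → 0`, the partial sums converge uniformly, and
the limit is `f` by the uniqueness of Fourier series in `L_1`.

*Lower bound.* Take `φ = l ∑_{k=n}^{M} b_k cos(kx + βπ/2)` with `b_k = ψ^{q-1}(k) k^{q-2}`. Since
`b_k^p k^{p-2} = b_k ψ(k) = ψ^q(k) k^{q-2}`, the same inequality in `L_p` bounds `‖φ‖_p` by a multiple
of `T_n^{1/p}`, while `f = l ∑ b_k ψ(k) cos kx` has nonnegative, decreasing coefficients: whichever
`2n` frequencies are removed, the value at `0` that remains is at least `l ∑_{k=2n}^{M} b_k ψ(k)`.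
Finally `T_{2n} ≥ (1 - q / α) T_n`.

The middle inequality compares `2n` with `2n - 1` frequencies: a far frequency can be added at
arbitrarily small cost.
-/

namespace OrthTrig

/-! ### Summation by parts and Hardy's inequality -/

/-- Summation by parts: the estimate is kept in the form that is stable under adding one more
term, so that a sum with nonincreasing coefficients is controlled by its first coefficient. -/
theorem norm_one_sub_mul_sum_add_le {a : ℕ → ℝ} (z : ℂ) (hz : ‖z‖ = 1) {m M : ℕ}
    (hmM : m ≤ M) (hanti : ∀ k, m ≤ k → a (k + 1) ≤ a k) (hm : 0 ≤ a m) :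
    ‖(1 - z) * ∑ k ∈ Finset.Icc m M, (a k : ℂ) * z ^ k + a M * z ^ (M + 1)‖ ≤ 2 * a m - a M := by
  induction M, hmM using Nat.le_induction with
  | base =>
    have : (1 - z) * ∑ k ∈ Finset.Icc m m, (a k : ℂ) * z ^ k + a m * z ^ (m + 1)
        = a m * z ^ m := by simp; ring
    rw [this]
    simp [hz, abs_of_nonneg hm]
    linarith
  | succ M hM ih =>
    have : (1 - z) * ∑ k ∈ Finset.Icc m (M + 1), (a k : ℂ) * z ^ k
          + a (M + 1) * z ^ (M + 1 + 1)
        = ((1 - z) * ∑ k ∈ Finset.Icc m M, (a k : ℂ) * z ^ k + a M * z ^ (M + 1))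
          + ((a (M + 1) - a M : ℝ) : ℂ) * z ^ (M + 1) := by
      rw [Finset.sum_Icc_succ_top (by omega)]; push_cast; ring
    rw [this]
    refine (norm_add_le _ _).trans ?_
    have h2 : ‖((a (M + 1) - a M : ℝ) : ℂ) * z ^ (M + 1)‖ = a M - a (M + 1) := by
      rw [norm_mul, norm_pow, hz, one_pow, mul_one, Complex.norm_real, Real.norm_eq_abs,
        abs_of_nonpos (by linarith [hanti M hM])]; ring
    rw [h2]; linarith

theorem norm_one_sub_mul_sum_le {a : ℕ → ℝ} (z : ℂ) (hz : ‖z‖ = 1) {m M : ℕ}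
    (hmM : m ≤ M) (hanti : ∀ k, m ≤ k → a (k + 1) ≤ a k) (hnn : ∀ k, m ≤ k → 0 ≤ a k) :
    ‖1 - z‖ * ‖∑ k ∈ Finset.Icc m M, (a k : ℂ) * z ^ k‖ ≤ 2 * a m := by
  have h := norm_one_sub_mul_sum_add_le z hz hmM hanti (hnn m le_rfl)
  rw [← norm_mul]
  have h3 := norm_sub_le ((1 - z) * ∑ k ∈ Finset.Icc m M, (a k : ℂ) * z ^ k + a M * z ^ (M + 1))
    (a M * z ^ (M + 1))
  rw [add_sub_cancel_right] at h3
  have h2 : ‖(a M : ℂ) * z ^ (M + 1)‖ = a M := by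
    rw [norm_mul, norm_pow, hz, one_pow, mul_one, Complex.norm_real, Real.norm_eq_abs,
        abs_of_nonneg (hnn M hmM)]
  linarith

theorem norm_sum_exp_le {a : ℕ → ℝ} {m M : ℕ} (hmM : m ≤ M)
    (hanti : ∀ k, m ≤ k → a (k + 1) ≤ a k) (hnn : ∀ k, m ≤ k → 0 ≤ a k)
    {t : ℝ} (ht : 0 < t) (htπ : t ≤ π) :
    ‖∑ k ∈ Finset.Icc m M, (a k : ℂ) * Complex.exp (t * Complex.I) ^ k‖ ≤ a m * (π / t) := by
  have h := norm_one_sub_mul_sum_le (Complex.exp (t * Complex.I))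
    (Complex.norm_exp_ofReal_mul_I t) hmM hanti hnn
  have h1 : 2 * t / π ≤ ‖1 - Complex.exp (t * Complex.I)‖ := by
    rw [norm_sub_rev, mul_comm (t : ℂ), Complex.norm_exp_I_mul_ofReal_sub_one, Real.norm_eq_abs]
    have := Real.mul_le_sin (x := t / 2) (by linarith) (by linarith)
    refine le_trans ?_ (le_abs_self _)
    calc 2 * t / π = 2 * (2 / π * (t / 2)) := by ring
      _ ≤ _ := by linarith
  have h2 := (mul_le_mul_of_nonneg_right h1 (norm_nonneg _)).trans h
  have hπ := Real.pi_pos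
  rw [mul_div_assoc', le_div_iff₀ ht]
  have : 2 * t / π * ‖∑ k ∈ Finset.Icc m M, (a k : ℂ) * Complex.exp (t * Complex.I) ^ k‖
     = (‖∑ k ∈ Finset.Icc m M, (a k : ℂ) * Complex.exp (t * Complex.I) ^ k‖ * t) * 2 / π := by ring
  rw [this, div_le_iff₀ hπ] at h2
  linarith

/-- The tangent-line bound for the convex power `x ↦ x ^ s`, taken at the right end point. It is
Bernoulli's inequality after scaling. -/
theorem rpow_sub_rpow_le {s u v : ℝ} (hs : 1 ≤ s) (hu : 0 ≤ u) (huv : 0 ≤ v) :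
    (u + v) ^ s - u ^ s ≤ s * (u + v) ^ (s - 1) * v := by
  rcases (add_nonneg hu huv).eq_or_lt with h | h
  · have hv : v = 0 := by linarith
    simp [hv]
  have hb := one_add_mul_self_le_rpow_one_add (s := -v / (u + v)) (p := s)
    (by rw [le_div_iff₀ h]; linarith) hs
  have e : 1 + -v / (u + v) = u / (u + v) := by field_simp; ring
  rw [e, Real.div_rpow hu h.le, le_div_iff₀ (by positivity)] at hb
  have e2 : (u + v) ^ s = (u + v) ^ (s - 1) * (u + v) := by
    rw [← Real.rpow_add_one h.ne']; ring_nf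
  have e3 : s * (-v / (u + v)) * (u + v) ^ s = - (s * (u + v) ^ (s - 1) * v) := by
    rw [e2]; field_simp
  linarith [add_mul 1 (s * (-v / (u + v))) ((u + v) ^ s)]

/-- Young's inequality with a non-optimal constant, which makes the first term small enough to be
absorbed in `hardy_sum_le`. -/
theorem mul_rpow_sub_one_mul_le {s u v : ℝ} (hs : 1 ≤ s) (hu : 0 ≤ u) (hv : 0 ≤ v) :
    s * u ^ (s - 1) * v ≤ u ^ s / 4 + (4 * s) ^ s / 4 * v ^ s := by
  have hs0 : 0 < s := by linarith
  rcases hv.eq_or_lt with rfl | hv'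
  · have : 0 ≤ u ^ s := by positivity
    rw [Real.zero_rpow hs0.ne']; linarith
  -- Either `s v ≤ u / 4`, or `u` is at most `4 s v`.
  rcases le_total (4 * s * v) u with h | h
  · have hu' : 0 < u := lt_of_lt_of_le (by positivity) h
    have e2 : u ^ s = u ^ (s - 1) * u := by rw [← Real.rpow_add_one hu'.ne']; ring_nf
    have := mul_le_mul_of_nonneg_left h (Real.rpow_nonneg hu (s - 1))
    have h3 : 0 ≤ (4 * s) ^ s / 4 * v ^ s := by positivity
    rw [e2]; linarith
  · have h1 : u ^ (s - 1) ≤ (4 * s * v) ^ (s - 1) := by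
      gcongr
    have e2 : (4 * s) ^ s * v ^ s = (4 * s * v) ^ (s - 1) * (4 * s * v) := by
      rw [← Real.rpow_add_one (by positivity), ← Real.mul_rpow (by positivity) hv]; ring_nf
    have h3 := mul_le_mul_of_nonneg_right h1 (show 0 ≤ s * v by positivity)
    have h4 : 0 ≤ u ^ s := by positivity
    have : (4 * s) ^ s / 4 * v ^ s = (4 * s * v) ^ (s - 1) * (s * v) := by
      linear_combination e2 / 4
    rw [this]
    linarith

/-- Summation by parts against the weights `1 / (N (N + 1)) = 1 / N - 1 / (N + 1)`. -/
theorem sum_div_mul_succ_eq (B : ℕ → ℝ) {n M : ℕ} (hn : 1 ≤ n) (hnM : n ≤ M) :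
    ∑ N ∈ Finset.Icc n M, B N / (N * (N + 1)) + B M / (M + 1)
      = B n / n + ∑ N ∈ Finset.Icc (n + 1) M, (B N - B (N - 1)) / N := by
  induction M, hnM using Nat.le_induction with
  | base =>
    have : (n : ℝ) ≠ 0 := by positivity
    simp; field_simp; ring
  | succ M hM ih =>
    rw [Finset.sum_Icc_succ_top (by omega), Finset.sum_Icc_succ_top (by omega), ← add_assoc, ← ih]
    have : (M : ℝ) ≠ 0 := by have : 1 ≤ M := hn.trans hM
                             positivity
    simp only [Nat.add_sub_cancel]
    push_cast
    field_simp
    ring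

/-- A finite form of Hardy's inequality. The extra term `A_M ^ s / (M + 1)` on the left is what
summing the weights `1 / (N (N + 1))` over all `N > M` would contribute, since the partial sums are
constant from `M` on. -/
theorem hardy_sum_le {a : ℕ → ℝ} {s : ℝ} (hs : 1 ≤ s) {n M : ℕ} (hn : 1 ≤ n) (hnM : n ≤ M)
    (hnn : ∀ k, n ≤ k → 0 ≤ a k) :
    ∑ N ∈ Finset.Icc n M, (∑ k ∈ Finset.Icc n N, a k) ^ s / (N * (N + 1))
        + (∑ k ∈ Finset.Icc n M, a k) ^ s / (M + 1)
      ≤ (4 * s) ^ s / 2 * ∑ k ∈ Finset.Icc n M, a k ^ s * (k : ℝ) ^ (s - 2) := by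
  have hs0 : 0 < s := by linarith
  set A : ℕ → ℝ := fun N => ∑ k ∈ Finset.Icc n N, a k with hA
  have hA0 : ∀ N, 0 ≤ A N := fun N => Finset.sum_nonneg fun k hk =>
    hnn k (Finset.mem_Icc.1 hk).1
  set X := ∑ N ∈ Finset.Icc n M, A N ^ s / (N * (N + 1)) + A M ^ s / (M + 1) with hX
  have key : ∀ N ∈ Finset.Icc n M, s * A N ^ (s - 1) * a N / N
      ≤ A N ^ s / (N * (N + 1)) / 2 + (4 * s) ^ s / 4 * (a N ^ s * (N : ℝ) ^ (s - 2)) := by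
    intro N hN
    obtain ⟨h1, h2⟩ := Finset.mem_Icc.1 hN
    have hN1 : (1 : ℝ) ≤ N := by exact_mod_cast hn.trans h1
    have hN0 : (0 : ℝ) < N := by linarith
    have h3 := mul_rpow_sub_one_mul_le hs (hA0 N) (mul_nonneg hN0.le (hnn N h1))
    have e : (N : ℝ) ^ (s - 2) = (N : ℝ) ^ s / (N : ℝ) ^ 2 := by
      rw [Real.rpow_sub hN0]; norm_num
    rw [Real.mul_rpow hN0.le (hnn N h1)] at h3
    rw [e]
    have h4 : A N ^ s / (4 * (N : ℝ) ^ 2) ≤ A N ^ s / (N * (N + 1)) / 2 := by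
      rw [div_div]
      have : 0 ≤ A N ^ s := Real.rpow_nonneg (hA0 N) _
      exact div_le_div_of_nonneg_left this (by positivity) (by nlinarith)
    calc s * A N ^ (s - 1) * a N / N = (s * A N ^ (s - 1) * (N * a N)) / (N : ℝ) ^ 2 := by
          field_simp
      _ ≤ (A N ^ s / 4 + (4 * s) ^ s / 4 * ((N : ℝ) ^ s * a N ^ s)) / (N : ℝ) ^ 2 := by gcongr
      _ = A N ^ s / (4 * (N : ℝ) ^ 2)
          + (4 * s) ^ s / 4 * (a N ^ s * ((N : ℝ) ^ s / (N : ℝ) ^ 2)) := by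
          field_simp
      _ ≤ _ := by linarith
  have hX1 : X ≤ ∑ N ∈ Finset.Icc n M, s * A N ^ (s - 1) * a N / N := by
    rw [hX, sum_div_mul_succ_eq (fun N => A N ^ s) hn hnM, ← Finset.add_sum_Ioc_eq_sum_Icc hnM,
      ← Finset.Icc_add_one_left_eq_Ioc]
    have hn0 : (0 : ℝ) < n := by exact_mod_cast hn
    refine add_le_add ?_ (Finset.sum_le_sum fun N hN => ?_)
    · have := rpow_sub_rpow_le hs le_rfl (hnn n le_rfl)
      have e : A n = a n := by simp [hA]
      simp only [zero_add, Real.zero_rpow hs0.ne', sub_zero] at this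
      simp only [e]
      gcongr
    · have hN' := Finset.mem_Icc.1 hN
      have e : A N = A (N - 1) + a N := by
        obtain ⟨N, rfl⟩ : ∃ N', N = N' + 1 := ⟨N - 1, by omega⟩
        simp only [hA, Nat.add_sub_cancel]
        rw [Finset.sum_Icc_succ_top (by omega)]
      have := rpow_sub_rpow_le hs (hA0 (N - 1)) (hnn N (by omega))
      rw [← e] at this
      gcongr
  -- Half of `X` appears on the right as well, and is absorbed.
  have hX2 := hX1.trans (Finset.sum_le_sum key)
  rw [Finset.sum_add_distrib, ← Finset.sum_div, ← Finset.mul_sum] at hX2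
  have h5 : 0 ≤ A M ^ s / (M + 1) := by have := hA0 M; positivity
  linarith

/-! ### The Hardy–Littlewood inequality on the line -/

theorem continuous_sum_exp (a : ℕ → ℝ) (n M : ℕ) :
    Continuous fun t : ℝ => ∑ k ∈ Finset.Icc n M, (a k : ℂ) * Complex.exp (t * Complex.I) ^ k := by
  fun_prop

theorem continuous_norm_sum_exp_rpow (a : ℕ → ℝ) (n M : ℕ) {s : ℝ} (hs : 0 ≤ s) :
    Continuous fun t : ℝ =>
      ‖∑ k ∈ Finset.Icc n M, (a k : ℂ) * Complex.exp (t * Complex.I) ^ k‖ ^ s :=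
  (continuous_sum_exp a n M).norm.rpow_const fun _ => Or.inr hs

theorem norm_sum_exp_le_sum {a : ℕ → ℝ} {n M : ℕ} (hnn : ∀ k, n ≤ k → 0 ≤ a k) (t : ℝ) :
    ‖∑ k ∈ Finset.Icc n M, (a k : ℂ) * Complex.exp (t * Complex.I) ^ k‖
      ≤ ∑ k ∈ Finset.Icc n M, a k := by
  refine norm_sum_le_of_le _ fun k hk => ?_
  rw [norm_mul, norm_pow, Complex.norm_exp_ofReal_mul_I, one_pow, mul_one, Complex.norm_real,
    Real.norm_eq_abs, abs_of_nonneg (hnn k (Finset.mem_Icc.1 hk).1)]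

/-- For `t ≥ 1 / (N + 1)` the first frequencies up to `N` are estimated trivially, the rest by
summation by parts. -/
theorem norm_sum_exp_le_sum_add {a : ℕ → ℝ} {n N M : ℕ} (hnN : n ≤ N) (hNM : N < M)
    (hanti : ∀ k, n ≤ k → a (k + 1) ≤ a k) (hnn : ∀ k, n ≤ k → 0 ≤ a k)
    {t : ℝ} (ht : 1 / ((N : ℝ) + 1) ≤ t) (htπ : t ≤ π) :
    ‖∑ k ∈ Finset.Icc n M, (a k : ℂ) * Complex.exp (t * Complex.I) ^ k‖
      ≤ (∑ k ∈ Finset.Icc n N, a k) + π * ((N + 1) * a (N + 1)) := by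
  have ht0 : 0 < t := lt_of_lt_of_le (by positivity) ht
  have hsplit : ∑ k ∈ Finset.Icc n M, (a k : ℂ) * Complex.exp (t * Complex.I) ^ k
      = ∑ k ∈ Finset.Icc n N, (a k : ℂ) * Complex.exp (t * Complex.I) ^ k
        + ∑ k ∈ Finset.Icc (N + 1) M, (a k : ℂ) * Complex.exp (t * Complex.I) ^ k := by
    have e : ∀ m M : ℕ, Finset.Icc m M = Finset.Ico m (M + 1) := fun m M => by ext; simp
    rw [e, e, e, Finset.sum_Ico_consecutive _ (by omega) (by omega)]
  rw [hsplit]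
  refine (norm_add_le _ _).trans (add_le_add (norm_sum_exp_le_sum hnn t) ?_)
  refine (norm_sum_exp_le (by omega) (fun k hk => hanti k (by omega))
    (fun k hk => hnn k (by omega)) ht0 htπ).trans ?_
  have h1 : π / t ≤ π * (N + 1) := by
    rw [div_le_iff₀ ht0]
    have : 1 ≤ ((N : ℝ) + 1) * t := by
      rw [div_le_iff₀ (by positivity)] at ht; linarith
    nlinarith [Real.pi_pos]
  have := hnn (N + 1) (by omega)
  nlinarith

/-- Away from the origin the sum is at most `a_n π / t`. -/
theorem integral_far_le {a : ℕ → ℝ} {s : ℝ} (hs : 1 < s) {n M : ℕ} (hn : 1 ≤ n) (hnM : n ≤ M)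
    (hanti : ∀ k, n ≤ k → a (k + 1) ≤ a k) (hnn : ∀ k, n ≤ k → 0 ≤ a k) :
    ∫ t in (1 / (n : ℝ))..π,
        ‖∑ k ∈ Finset.Icc n M, (a k : ℂ) * Complex.exp (t * Complex.I) ^ k‖ ^ s
      ≤ π ^ s / (s - 1) * (a n ^ s * (n : ℝ) ^ (s - 1)) := by
  have hn0 : (0 : ℝ) < n := by exact_mod_cast hn
  have hn1 : 1 / (n : ℝ) ≤ π := by
    rw [div_le_iff₀ hn0]
    have : (1 : ℝ) ≤ n := by exact_mod_cast hn
    nlinarith [Real.pi_gt_three]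
  have h0 : (0 : ℝ) ∉ uIcc (1 / (n : ℝ)) π := by
    rw [uIcc_of_le hn1]; intro h; exact absurd h.1 (not_le.2 (by positivity))
  have hle : ∫ t in (1 / (n : ℝ))..π,
        ‖∑ k ∈ Finset.Icc n M, (a k : ℂ) * Complex.exp (t * Complex.I) ^ k‖ ^ s
      ≤ ∫ t in (1 / (n : ℝ))..π, (a n * π) ^ s * t ^ (-s) := by
    refine intervalIntegral.integral_mono_on hn1
      ((continuous_norm_sum_exp_rpow a n M (by linarith)).intervalIntegrable _ _)
      ((intervalIntegral.intervalIntegrable_rpow (Or.inr h0)).const_mul _) fun t ht => ?_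
    have ht0 : 0 < t := lt_of_lt_of_le (by positivity) ht.1
    have := hnn n le_rfl
    rw [Real.rpow_neg ht0.le, ← div_eq_mul_inv, ← Real.div_rpow (by positivity) ht0.le,
      mul_div_assoc]
    gcongr
    exact norm_sum_exp_le hnM hanti hnn ht0 ht.2
  refine hle.trans ?_
  rw [intervalIntegral.integral_const_mul, integral_rpow (Or.inr ⟨by linarith, h0⟩)]
  have e1 : (1 / (n : ℝ)) ^ (-s + 1) = (n : ℝ) ^ (s - 1) := by
    rw [one_div, Real.inv_rpow hn0.le, ← Real.rpow_neg hn0.le]; ring_nf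
  rw [e1, Real.mul_rpow (hnn n le_rfl) Real.pi_pos.le]
  have h2 : (π ^ (-s + 1) - (n : ℝ) ^ (s - 1)) / (-s + 1) ≤ (n : ℝ) ^ (s - 1) / (s - 1) := by
    have : (π ^ (-s + 1) - (n : ℝ) ^ (s - 1)) / (-s + 1)
        = ((n : ℝ) ^ (s - 1) - π ^ (-s + 1)) / (s - 1) := by
      rw [← neg_div_neg_eq]; ring_nf
    rw [this]
    have := Real.rpow_pos_of_pos Real.pi_pos (-s + 1)
    have hs' : 0 < s - 1 := by linarith
    gcongr
    linarith
  have := hnn n le_rfl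
  calc a n ^ s * π ^ s * ((π ^ (-s + 1) - (n : ℝ) ^ (s - 1)) / (-s + 1))
      ≤ a n ^ s * π ^ s * ((n : ℝ) ^ (s - 1) / (s - 1)) := by gcongr
    _ = _ := by ring

theorem add_rpow_le_two_rpow_mul {s u v : ℝ} (hs : 0 ≤ s) (hu : 0 ≤ u) (hv : 0 ≤ v) :
    (u + v) ^ s ≤ 2 ^ s * (u ^ s + v ^ s) := by
  have h1 : (u + v) ^ s ≤ (2 * max u v) ^ s := by
    gcongr; linarith [le_max_left u v, le_max_right u v]
  rw [Real.mul_rpow (by norm_num) (le_max_of_le_left hu)] at h1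
  refine h1.trans ?_
  have := Real.rpow_nonneg hu s
  have := Real.rpow_nonneg hv s
  gcongr
  rcases max_choice u v with h | h <;> rw [h] <;> linarith

/-- Near the origin the interval is cut at the points `1 / N`; the trivial part of the estimate on
each piece is summed by Hardy's inequality. -/
theorem integral_near_le {a : ℕ → ℝ} {s : ℝ} (hs : 1 < s) {n M : ℕ} (hn : 1 ≤ n) (hnM : n ≤ M)
    (hanti : ∀ k, n ≤ k → a (k + 1) ≤ a k) (hnn : ∀ k, n ≤ k → 0 ≤ a k) :
    ∫ t in (0 : ℝ)..(1 / (n : ℝ)),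
        ‖∑ k ∈ Finset.Icc n M, (a k : ℂ) * Complex.exp (t * Complex.I) ^ k‖ ^ s
      ≤ ((8 * s) ^ s / 2 + 2 * (2 * π) ^ s) *
          ∑ k ∈ Finset.Icc n M, a k ^ s * (k : ℝ) ^ (s - 2) := by
  have hs0 : 0 < s := by linarith
  set F : ℝ → ℝ := fun t =>
    ‖∑ k ∈ Finset.Icc n M, (a k : ℂ) * Complex.exp (t * Complex.I) ^ k‖ ^ s with hF
  have hFc : Continuous F := continuous_norm_sum_exp_rpow a n M hs0.le
  have hFi : ∀ x y, IntervalIntegrable F volume x y := fun x y => hFc.intervalIntegrable x y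
  set A : ℕ → ℝ := fun N => ∑ k ∈ Finset.Icc n N, a k with hA
  have hA0 : ∀ N, 0 ≤ A N := fun N => Finset.sum_nonneg fun k hk =>
    hnn k (Finset.mem_Icc.1 hk).1
  have hM0 : (0 : ℝ) < M := by exact_mod_cast hn.trans hnM
  set Y := ∑ k ∈ Finset.Icc n M, a k ^ s * (k : ℝ) ^ (s - 2) with hY
  have hdecomp : ∫ t in (0 : ℝ)..(1 / (n : ℝ)), F t
      = (∫ t in (0 : ℝ)..(1 / (M : ℝ)), F t)
        + ∑ N ∈ Finset.Ico n M, ∫ t in (1 / ((N : ℝ) + 1))..(1 / (N : ℝ)), F t := by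
    have h1 := intervalIntegral.sum_integral_adjacent_intervals_Ico (f := F) (μ := volume)
      (a := fun N : ℕ => 1 / (N : ℝ)) hnM (fun k _ => hFi _ _)
    have h2 : ∑ N ∈ Finset.Ico n M, ∫ t in (1 / ((N : ℝ) + 1))..(1 / (N : ℝ)), F t
        = ∫ t in (1 / (M : ℝ))..(1 / (n : ℝ)), F t := by
      rw [intervalIntegral.integral_symm (1 / (n : ℝ)), ← h1, ← Finset.sum_neg_distrib]
      refine Finset.sum_congr rfl fun N _ => ?_
      rw [intervalIntegral.integral_symm]; push_cast; rfl
    rw [h2, intervalIntegral.integral_add_adjacent_intervals (hFi _ _) (hFi _ _)]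
  have hnear : ∫ t in (0 : ℝ)..(1 / (M : ℝ)), F t ≤ A M ^ s / M := by
    have : ∫ t in (0 : ℝ)..(1 / (M : ℝ)), F t ≤ ∫ t in (0 : ℝ)..(1 / (M : ℝ)), A M ^ s := by
      refine intervalIntegral.integral_mono_on (by positivity) (hFi _ _)
        intervalIntegrable_const fun t _ => ?_
      simp only [hF]
      gcongr
      exact norm_sum_exp_le_sum hnn t
    refine this.trans (le_of_eq ?_)
    rw [intervalIntegral.integral_const, smul_eq_mul]; ring
  have hmid : ∀ N ∈ Finset.Ico n M, ∫ t in (1 / ((N : ℝ) + 1))..(1 / (N : ℝ)), F t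
      ≤ 2 ^ s * (A N ^ s / (N * (N + 1)))
        + 2 * (2 * π) ^ s * (a (N + 1) ^ s * ((N + 1 : ℕ) : ℝ) ^ (s - 2)) := by
    intro N hN
    obtain ⟨h1, h2⟩ := Finset.mem_Ico.1 hN
    have hN1 : (1 : ℝ) ≤ N := by exact_mod_cast hn.trans h1
    have hN0 : (0 : ℝ) < N := by linarith
    have haN := hnn (N + 1) (by omega)
    have hle : 1 / ((N : ℝ) + 1) ≤ 1 / (N : ℝ) := one_div_le_one_div_of_le hN0 (by linarith)
    have hNπ : 1 / (N : ℝ) ≤ π := by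
      rw [div_le_iff₀ hN0]; nlinarith [Real.pi_gt_three]
    set C := (A N + π * ((N + 1) * a (N + 1))) ^ s with hC
    have : ∫ t in (1 / ((N : ℝ) + 1))..(1 / (N : ℝ)), F t
        ≤ ∫ t in (1 / ((N : ℝ) + 1))..(1 / (N : ℝ)), C := by
      refine intervalIntegral.integral_mono_on hle (hFi _ _)
        intervalIntegrable_const fun t ht => ?_
      simp only [hF, hC]
      gcongr
      exact norm_sum_exp_le_sum_add h1 h2 hanti hnn ht.1 (ht.2.trans hNπ)
    refine this.trans ?_
    rw [intervalIntegral.integral_const, smul_eq_mul]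
    have hw : 1 / (N : ℝ) - 1 / ((N : ℝ) + 1) = 1 / (N * (N + 1)) := by field_simp; ring
    rw [hw]
    have hC2 : C ≤ 2 ^ s * (A N ^ s + π ^ s * ((N + 1) ^ s * a (N + 1) ^ s)) := by
      rw [← Real.mul_rpow (by positivity) haN, ← Real.mul_rpow (by positivity) (by positivity)]
      exact add_rpow_le_two_rpow_mul hs0.le (hA0 N) (by positivity)
    have e : ((N + 1 : ℕ) : ℝ) ^ (s - 2) = ((N : ℝ) + 1) ^ s / ((N : ℝ) + 1) ^ 2 := by
      push_cast
      rw [Real.rpow_sub (by positivity)]; norm_num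
    rw [e, Real.mul_rpow (by norm_num) Real.pi_pos.le]
    have h5 : 1 / ((N : ℝ) * (N + 1)) ≤ 2 / ((N : ℝ) + 1) ^ 2 := by
      rw [div_le_div_iff₀ (by positivity) (by positivity)]; nlinarith
    calc 1 / ((N : ℝ) * (N + 1)) * C
        ≤ 1 / ((N : ℝ) * (N + 1)) *
          (2 ^ s * (A N ^ s + π ^ s * ((N + 1) ^ s * a (N + 1) ^ s))) := by gcongr
      _ = 2 ^ s * (A N ^ s / (N * (N + 1)))
          + 2 ^ s * π ^ s * ((N + 1) ^ s * a (N + 1) ^ s) * (1 / ((N : ℝ) * (N + 1))) := by ring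
      _ ≤ 2 ^ s * (A N ^ s / (N * (N + 1)))
          + 2 ^ s * π ^ s * ((N + 1) ^ s * a (N + 1) ^ s) * (2 / ((N : ℝ) + 1) ^ 2) := by gcongr
      _ = _ := by ring
  have hsum := Finset.sum_le_sum hmid
  rw [Finset.sum_add_distrib, ← Finset.mul_sum, ← Finset.mul_sum] at hsum
  have hY2 : ∑ N ∈ Finset.Ico n M, a (N + 1) ^ s * ((N + 1 : ℕ) : ℝ) ^ (s - 2) ≤ Y := by
    rw [Finset.sum_Ico_add' (fun k : ℕ => a k ^ s * (k : ℝ) ^ (s - 2)) n M 1]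
    refine Finset.sum_le_sum_of_subset_of_nonneg (fun k hk => ?_) fun k hk _ => ?_
    · simp only [Finset.mem_Ico, Finset.mem_Icc] at *; omega
    · have := hnn k (Finset.mem_Icc.1 hk).1
      positivity
  have hH := hardy_sum_le hs.le hn hnM hnn
  rw [← Finset.sum_Ico_add_eq_sum_Icc hnM] at hH
  have hM : A M ^ s / M = A M ^ s / (M * (M + 1)) + A M ^ s / (M + 1) := by field_simp; ring
  have h2s : (1 : ℝ) ≤ 2 ^ s := Real.one_le_rpow (by norm_num) hs0.le
  have hAM : A M ^ s / M ≤ 2 ^ s * (A M ^ s / M) :=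
    le_mul_of_one_le_left (by have := hA0 M; positivity) h2s
  have hH2 := mul_le_mul_of_nonneg_left hH (show (0 : ℝ) ≤ 2 ^ s by positivity)
  have e8 : (8 * s) ^ s = 2 ^ s * (4 * s) ^ s := by
    rw [← Real.mul_rpow (by norm_num) (by positivity)]; ring_nf
  have hY3 := mul_le_mul_of_nonneg_left hY2 (show (0 : ℝ) ≤ 2 * (2 * π) ^ s by positivity)
  rw [hdecomp, e8]
  rw [hM] at hnear hAM
  simp only [← hY] at hH2
  nlinarith

/-- The Hardy–Littlewood inequality for sums with nonnegative nonincreasing coefficients. -/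
theorem integral_norm_sum_exp_rpow_le {a : ℕ → ℝ} {s : ℝ} (hs : 1 < s) {n M : ℕ} (hn : 1 ≤ n)
    (hnM : n ≤ M) (hanti : ∀ k, n ≤ k → a (k + 1) ≤ a k) (hnn : ∀ k, n ≤ k → 0 ≤ a k) :
    ∫ t in (-π)..π,
        ‖∑ k ∈ Finset.Icc n M, (a k : ℂ) * Complex.exp (t * Complex.I) ^ k‖ ^ s
      ≤ 4 ^ s * π / (s - 1) * (a n ^ s * (n : ℝ) ^ (s - 1))
        + 14 ^ s * (8 * π) * s ^ s * ∑ k ∈ Finset.Icc n M, a k ^ s * (k : ℝ) ^ (s - 2) := by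
  have hs0 : 0 < s := by linarith
  set F : ℝ → ℝ := fun t =>
    ‖∑ k ∈ Finset.Icc n M, (a k : ℂ) * Complex.exp (t * Complex.I) ^ k‖ ^ s with hF
  have hFc : Continuous F := continuous_norm_sum_exp_rpow a n M hs0.le
  have hFi : ∀ x y, IntervalIntegrable F volume x y := fun x y => hFc.intervalIntegrable x y
  have heven : ∀ t, F (-t) = F t := by
    intro t
    simp only [hF]
    rw [← Complex.norm_conj]
    congr 2
    rw [map_sum]
    refine Finset.sum_congr rfl fun k _ => ?_
    rw [map_mul, map_pow, ← Complex.exp_conj]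
    simp
  -- The coefficients are real, so `‖F‖` is even.
  have h1 : ∫ t in (-π)..π, F t = 2 * ∫ t in (0 : ℝ)..π, F t := by
    rw [← intervalIntegral.integral_add_adjacent_intervals (hFi (-π) 0) (hFi 0 π)]
    have := intervalIntegral.integral_comp_neg (a := 0) (b := π) F
    simp only [heven, neg_zero] at this
    rw [← this]; ring
  rw [h1, ← intervalIntegral.integral_add_adjacent_intervals (hFi 0 (1 / n)) (hFi (1 / n) π)]
  have hfar := integral_far_le hs hn hnM hanti hnn
  have hnear := integral_near_le hs hn hnM hanti hnn
  have hY : 0 ≤ ∑ k ∈ Finset.Icc n M, a k ^ s * (k : ℝ) ^ (s - 2) :=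
    Finset.sum_nonneg fun k hk => by
      have := hnn k (Finset.mem_Icc.1 hk).1; positivity
  set Y := ∑ k ∈ Finset.Icc n M, a k ^ s * (k : ℝ) ^ (s - 2)
  have hG : 0 ≤ a n ^ s * (n : ℝ) ^ (s - 1) := by have := hnn n le_rfl; positivity
  have hs' : 0 < s - 1 := by linarith
  have c1 : 2 * (π ^ s / (s - 1)) ≤ 4 ^ s * π / (s - 1) := by
    rw [mul_div_assoc']
    refine div_le_div_of_nonneg_right ?_ hs'.le
    have e1 : π ^ s = π ^ (s - 1) * π := by
      rw [← Real.rpow_add_one Real.pi_pos.ne']; ring_nf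
    have e2 : (4 : ℝ) ^ s = 4 ^ (s - 1) * 4 := by
      rw [← Real.rpow_add_one (by norm_num)]; ring_nf
    have h : π ^ (s - 1) ≤ 4 ^ (s - 1) := by
      gcongr; exact Real.pi_le_four
    have h4 : (0 : ℝ) ≤ 4 ^ (s - 1) := by positivity
    rw [e1, e2]
    nlinarith [Real.pi_pos]
  have c2 : 2 * ((8 * s) ^ s / 2 + 2 * (2 * π) ^ s) ≤ 14 ^ s * (8 * π) * s ^ s := by
    have h8 : (8 * s) ^ s ≤ 14 ^ s * s ^ s := by
      rw [← Real.mul_rpow (by norm_num) hs0.le]; gcongr; norm_num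
    have h9 : (2 * π) ^ s ≤ 14 ^ s * s ^ s := by
      rw [← Real.mul_rpow (by norm_num) hs0.le]
      exact Real.rpow_le_rpow (by positivity) (by linarith [Real.pi_le_four]) hs0.le
    have h10 : 0 ≤ (14 : ℝ) ^ s * s ^ s := by positivity
    nlinarith [Real.pi_gt_three]
  have d1 := mul_le_mul_of_nonneg_right c1 hG
  have d2 := mul_le_mul_of_nonneg_right c2 hY
  linarith

/-! ### Norms of trigonometric polynomials on the circle -/

/-- The trigonometric polynomial `∑_{k = n}^{M} a_k e^{ikt}` on the circle. -/
noncomputable def expSum (a : ℕ → ℝ) (n M : ℕ) (t : Circ) : ℂ :=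
  ∑ k ∈ Finset.Icc n M, (a k : ℂ) * fourier (k : ℤ) t

theorem continuous_expSum (a : ℕ → ℝ) (n M : ℕ) : Continuous (expSum a n M) := by
  unfold expSum; fun_prop

theorem expSum_coe (a : ℕ → ℝ) (n M : ℕ) (x : ℝ) :
    expSum a n M (x : Circ)
      = ∑ k ∈ Finset.Icc n M, (a k : ℂ) * Complex.exp (x * Complex.I) ^ k := by
  refine Finset.sum_congr rfl fun k _ => ?_
  rw [fourier_coe_apply, ← Complex.exp_nat_mul]
  congr 2
  have : (π : ℂ) ≠ 0 := by exact_mod_cast Real.pi_ne_zero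
  push_cast
  field_simp

theorem integral_norm_expSum_rpow_le {a : ℕ → ℝ} {s : ℝ} (hs : 1 < s) {n M : ℕ} (hn : 1 ≤ n)
    (hnM : n ≤ M) (hanti : ∀ k, n ≤ k → a (k + 1) ≤ a k) (hnn : ∀ k, n ≤ k → 0 ≤ a k) :
    ∫ t : Circ, ‖expSum a n M t‖ ^ s
      ≤ 4 ^ s * π / (s - 1) * (a n ^ s * (n : ℝ) ^ (s - 1))
        + 14 ^ s * (8 * π) * s ^ s * ∑ k ∈ Finset.Icc n M, a k ^ s * (k : ℝ) ^ (s - 2) := by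
  rw [← AddCircle.intervalIntegral_preimage (2 * π) (-π) fun t => ‖expSum a n M t‖ ^ s]
  have e : -π + 2 * π = π := by ring
  simp only [e, expSum_coe]
  exact integral_norm_sum_exp_rpow_le hs hn hnM hanti hnn

theorem xi_pos {s : ℝ} (hs : 1 < s) : 0 < xi s := by
  have : 0 < s - 1 := by linarith
  have := Real.pi_pos
  exact lt_max_of_lt_left (by positivity)

/-- The `L_s` norm in terms of `ξ(s)`. The two terms of the Hardy–Littlewood bound carry the two
constants in the definition of `ξ(s)`; as these multiply `r T` and `T` respectively, replacing both
by their maximum produces the factor `1 + r`. -/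
theorem rpow_norm_expSum_le {a : ℕ → ℝ} {s : ℝ} (hs : 1 < s) {n M : ℕ} (hn : 1 ≤ n)
    (hnM : n ≤ M) (hanti : ∀ k, n ≤ k → a (k + 1) ≤ a k) (hnn : ∀ k, n ≤ k → 0 ≤ a k)
    {r T : ℝ} (hT : ∑ k ∈ Finset.Icc n M, a k ^ s * (k : ℝ) ^ (s - 2) ≤ T)
    (hr : a n ^ s * (n : ℝ) ^ (s - 1) ≤ r * T) :
    (∫ t : Circ, ‖expSum a n M t‖ ^ s) ^ (1 / s) ≤ xi s * ((1 + r) * T) ^ (1 / s) := by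
  have hs0 : 0 < s := by linarith
  have hs1 : 0 < s - 1 := by linarith
  have hπ := Real.pi_pos
  have hY : 0 ≤ ∑ k ∈ Finset.Icc n M, a k ^ s * (k : ℝ) ^ (s - 2) :=
    Finset.sum_nonneg fun k hk => by
      have := hnn k (Finset.mem_Icc.1 hk).1; positivity
  have hG : 0 ≤ a n ^ s * (n : ℝ) ^ (s - 1) := by have := hnn n le_rfl; positivity
  have c1 : 4 ^ s * π / (s - 1) ≤ xi s ^ s := by
    have e : 4 ^ s * π / (s - 1) = (4 * (π / (s - 1)) ^ (1 / s)) ^ s := by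
      rw [Real.mul_rpow (by norm_num) (by positivity), ← Real.rpow_mul (by positivity),
        one_div_mul_cancel hs0.ne', Real.rpow_one, mul_div_assoc]
    rw [e]
    exact Real.rpow_le_rpow (by positivity) (le_max_left _ _) hs0.le
  have c2 : 14 ^ s * (8 * π) * s ^ s ≤ xi s ^ s := by
    have e : 14 ^ s * (8 * π) * s ^ s = (14 * (8 * π) ^ (1 / s) * s) ^ s := by
      rw [Real.mul_rpow (by positivity) hs0.le, Real.mul_rpow (by norm_num) (by positivity),
        ← Real.rpow_mul (by positivity), one_div_mul_cancel hs0.ne', Real.rpow_one]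
    rw [e]
    exact Real.rpow_le_rpow (by positivity) (le_max_right _ _) hs0.le
  have hx : 0 ≤ xi s ^ s := Real.rpow_nonneg (xi_pos hs).le _
  have hle : ∫ t : Circ, ‖expSum a n M t‖ ^ s ≤ xi s ^ s * ((1 + r) * T) := by
    refine (integral_norm_expSum_rpow_le hs hn hnM hanti hnn).trans ?_
    have d1 := mul_le_mul_of_nonneg_right c1 hG
    have d2 := mul_le_mul_of_nonneg_right c2 hY
    have d3 := mul_le_mul_of_nonneg_left hr hx
    have d4 := mul_le_mul_of_nonneg_left hT hx
    linarith
  have h0 : 0 ≤ ∫ t : Circ, ‖expSum a n M t‖ ^ s := integral_nonneg fun t => by positivity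
  have := Real.rpow_le_rpow h0 hle (show 0 ≤ 1 / s by positivity)
  rwa [Real.mul_rpow hx (by linarith), ← Real.rpow_mul (xi_pos hs).le,
    mul_one_div_cancel hs0.ne', Real.rpow_one] at this

theorem coeff_eq_integral (f : Circ → ℝ) (k : ℤ) :
    coeff f k = (1 / (2 * π) : ℂ) * ∫ t : Circ, fourier (-k) t * (f t : ℂ) := by
  unfold coeff fourierCoeff
  rw [AddCircle.integral_haarAddCircle, Complex.real_smul]
  simp

/-! ### Convex functions with a lower bound for `α` -/

theorem ClassM.antitoneOn {g : ℝ → ℝ} (hg : ClassM g) : AntitoneOn g (Ici 1) := by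
  obtain ⟨hpos, -, hconv, hlim⟩ := hg
  intro x hx y hy hxy
  by_contra! h
  have hxy' : x < y := lt_of_le_of_ne hxy fun e => by simp [e] at h
  have h1 : ∀ᶠ z in atTop, g y ≤ g z := by
    filter_upwards [eventually_gt_atTop y] with z hz
    have := hconv.slope_mono_adjacent hx (le_trans hy hz.le : z ∈ Ici (1 : ℝ)) hxy' hz
    have h2 : 0 < (g y - g x) / (y - x) := div_pos (by linarith) (by linarith)
    have h3 : 0 < (g z - g y) / (z - y) := h2.trans_le this
    have := (div_pos_iff_of_pos_right (by linarith : 0 < z - y)).1 h3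
    linarith
  exact absurd (ge_of_tendsto hlim h1) (not_le.2 (hpos y hy))

theorem alpha_nonneg {g : ℝ → ℝ} (hg : ClassM g) {t : ℝ} (ht : 1 ≤ t) : 0 ≤ alpha g t := by
  have := hg.1 t ht
  unfold alpha
  positivity

theorem lowerAlpha_one_le {g : ℝ → ℝ} (hg : ClassM g) {t : ℝ} (ht : 1 ≤ t) :
    lowerAlpha g 1 ≤ alpha g t := by
  refine csInf_le ⟨0, ?_⟩ ⟨t, by simpa using ht, rfl⟩
  rintro _ ⟨u, hu, rfl⟩
  exact alpha_nonneg hg (by simpa using hu)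

/-- A lower bound for `α(g; t)` bounds the right derivative, and by convexity the graph of `g` lies
above its right tangent. -/
theorem ClassM.mul_one_sub_le {g : ℝ → ℝ} (hg : ClassM g) {A : ℝ} (hA : 0 < A)
    {t : ℝ} (ht : 1 ≤ t) (hAt : A ≤ alpha g t) :
    g t * (1 - 1 / (A * t)) ≤ g (t + 1) := by
  obtain ⟨hpos, -, hconv, hlim⟩ := hg
  set D := derivWithin g (Ioi t) t with hD
  have ht0 : 0 < t := by linarith
  -- A vanishing (possibly junk) derivative would make `alpha g t` equal to zero.
  have hD0 : D ≠ 0 := by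
    intro h
    simp only [alpha, ← hD, h] at hAt
    simp at hAt; linarith
  have hdiff : DifferentiableWithinAt ℝ g (Ioi t) t := by
    by_contra h
    exact hD0 (derivWithin_zero_of_not_differentiableWithinAt h)
  have hs := hconv.rightDeriv_le_slope (show t ∈ Ici (1 : ℝ) from ht)
    (show t + 1 ∈ Ici (1 : ℝ) from by simp; linarith) (by linarith) hdiff
  rw [slope_def_field, add_sub_cancel_left, div_one] at hs
  have hDp : 0 < |D| := abs_pos.2 hD0
  have h1 : A * (t * |D|) ≤ g t := by
    rwa [alpha, ← hD, le_div_iff₀ (by positivity)] at hAt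
  have h2 : |D| ≤ g t / (A * t) := by
    rw [le_div_iff₀ (by positivity)]; linarith
  have h3 := neg_abs_le D
  have : g t * (1 - 1 / (A * t)) = g t - g t / (A * t) := by ring
  linarith

section
variable {p q : ℝ} {ψ : ℝ → ℝ}

/-- In terms of `g_p` the term `ψ^q(k) k^{q-2}` is `g_p(k)^q / k`. -/
theorem term_eq_gFun_rpow_div (hpq : 1 / p + 1 / q = 1) (hq : 1 < q)
    (hg : ClassM (gFun ψ p)) {k : ℕ} (hk : 1 ≤ k) :
    term ψ q k = gFun ψ p k ^ q / k := by
  have hk0 : (0 : ℝ) < k := by exact_mod_cast hk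
  have hψ : 0 < ψ k := by
    have := hg.1 k (by simpa using hk)
    exact pos_of_mul_pos_left this (by positivity)
  rw [gFun, Real.mul_rpow hψ.le (by positivity), ← Real.rpow_mul hk0.le, term, mul_div_assoc]
  congr 1
  have e : 1 / p * q = q - 1 := by
    have : 1 / p = 1 - 1 / q := by linarith
    rw [this]; field_simp
  rw [e, ← Real.rpow_sub_one hk0.ne']; ring_nf

theorem gFun_rpow_sub_le (hpq : 1 / p + 1 / q = 1) (hq : 1 < q) (hg : ClassM (gFun ψ p))
    (hα : q < lowerAlpha (gFun ψ p) 1) {k : ℕ} (hk : 1 ≤ k) :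
    gFun ψ p k ^ q - gFun ψ p (k + 1 : ℕ) ^ q ≤ q / lowerAlpha (gFun ψ p) 1 * term ψ q k := by
  set A := lowerAlpha (gFun ψ p) 1
  have hA : 0 < A := by linarith
  have hk1 : (1 : ℝ) ≤ k := by exact_mod_cast hk
  have hk0 : (0 : ℝ) < k := by linarith
  have hgk := hg.1 k hk1
  have h1 := hg.mul_one_sub_le hA hk1 (lowerAlpha_one_le hg hk1)
  have hAk : 1 / (A * k) ≤ 1 := by
    rw [div_le_one (by positivity)]; nlinarith
  have h2 := one_add_mul_self_le_rpow_one_add (s := -(1 / (A * k))) (by linarith) hq.le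
  rw [term_eq_gFun_rpow_div hpq hq hg hk]
  push_cast
  have h3 : (gFun ψ p k * (1 - 1 / (A * k))) ^ q ≤ gFun ψ p (k + 1) ^ q :=
    Real.rpow_le_rpow (mul_nonneg hgk.le (by linarith)) h1 (by linarith)
  rw [Real.mul_rpow hgk.le (by linarith)] at h3
  have h4 : 0 ≤ gFun ψ p k ^ q := by positivity
  have h5 := mul_le_mul_of_nonneg_left h2 h4
  rw [← sub_eq_add_neg] at h5
  have e : q / A * (gFun ψ p k ^ q / k) = gFun ψ p k ^ q * (q * (1 / (A * k))) := by
    field_simp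
  rw [e]
  linarith

theorem term_nonneg (hg : ClassM (gFun ψ p)) {k : ℕ} (hk : 1 ≤ k) : 0 ≤ term ψ q k := by
  have hψ : 0 < ψ k := by
    have := hg.1 k (by simpa using hk)
    exact pos_of_mul_pos_left this (by positivity)
  unfold term; positivity

theorem summable_term_add (hsum : Summable fun j : ℕ => term ψ q (j + 1)) (n : ℕ) :
    Summable fun j : ℕ => term ψ q (n + j) := by
  have h := (summable_nat_add_iff 1).1 hsum
  simpa [add_comm] using (summable_nat_add_iff n).2 h

/-- The boundary term of the Hardy–Littlewood bound is controlled by the tail sum, by telescoping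
`gFun_rpow_sub_le`. -/
theorem gFun_rpow_le_tailSum (hpq : 1 / p + 1 / q = 1) (hq : 1 < q) (hg : ClassM (gFun ψ p))
    (hα : q < lowerAlpha (gFun ψ p) 1) (hsum : Summable fun j : ℕ => term ψ q (j + 1))
    {n : ℕ} (hn : 1 ≤ n) :
    gFun ψ p n ^ q ≤ q / lowerAlpha (gFun ψ p) 1 * tailSum ψ q n := by
  have h1 : ∀ J : ℕ, gFun ψ p n ^ q - gFun ψ p (n + J : ℕ) ^ q
      ≤ q / lowerAlpha (gFun ψ p) 1 * ∑ j ∈ Finset.range J, term ψ q (n + j) := by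
    intro J
    induction J with
    | zero => simp
    | succ J ih =>
      have := gFun_rpow_sub_le hpq hq hg hα (k := n + J) (by omega)
      rw [Finset.sum_range_succ, mul_add, ← add_assoc]
      linarith
  have hl : Tendsto (fun J : ℕ => gFun ψ p (n + J : ℕ)) atTop (𝓝 0) := by
    refine hg.2.2.2.comp (tendsto_natCast_atTop_atTop.comp ?_)
    exact tendsto_atTop_mono (fun J => Nat.le_add_left J n) tendsto_id
  have hl2 := hl.rpow_const (p := q) (Or.inr (by linarith))
  rw [Real.zero_rpow (by linarith)] at hl2
  have h2 := le_of_tendsto_of_tendsto' (hl2.const_sub (gFun ψ p n ^ q))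
    ((summable_term_add hsum n).tendsto_sum_tsum_nat.const_mul _) h1
  simpa [tailSum] using h2

/-- Doubling the starting index loses only the factor `1 - q / α`: the `n` terms that are dropped
are each at most `g_p(n)^q / n`. -/
theorem one_sub_mul_tailSum_le (hpq : 1 / p + 1 / q = 1) (hq : 1 < q) (hg : ClassM (gFun ψ p))
    (hα : q < lowerAlpha (gFun ψ p) 1) (hsum : Summable fun j : ℕ => term ψ q (j + 1))
    {n : ℕ} (hn : 1 ≤ n) :
    (1 - q / lowerAlpha (gFun ψ p) 1) * tailSum ψ q n ≤ tailSum ψ q (2 * n) := by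
  have h1 := (summable_term_add hsum n).sum_add_tsum_nat_add n
  have e : ∑' j : ℕ, term ψ q (n + (j + n)) = tailSum ψ q (2 * n) := by
    unfold tailSum; congr 1; ext j; congr 1; ring
  rw [e] at h1
  have hn0 : (0 : ℝ) < n := by exact_mod_cast hn
  have h2 : ∑ j ∈ Finset.range n, term ψ q (n + j) ≤ ∑ j ∈ Finset.range n, gFun ψ p n ^ q / n := by
    refine Finset.sum_le_sum fun j _ => ?_
    rw [term_eq_gFun_rpow_div hpq hq hg (by omega)]
    have h3 : gFun ψ p (n + j : ℕ) ≤ gFun ψ p n :=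
      hg.antitoneOn (show (1 : ℝ) ≤ n by exact_mod_cast hn)
        (show (1 : ℝ) ≤ (n + j : ℕ) by exact_mod_cast (by omega))
        (by push_cast; linarith [(Nat.cast_nonneg j : (0 : ℝ) ≤ j)])
    have h4 := hg.1 (n + j : ℕ) (show (1 : ℝ) ≤ (n + j : ℕ) by exact_mod_cast (by omega))
    have h5 : (n : ℝ) ≤ (n + j : ℕ) := by exact_mod_cast (by omega)
    have h6 := h4.trans_le h3
    gcongr
  rw [Finset.sum_const, Finset.card_range, nsmul_eq_mul, mul_div_cancel₀ _ hn0.ne'] at h2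
  have h3 := gFun_rpow_le_tailSum hpq hq hg hα hsum hn
  have : tailSum ψ q n = ∑' j : ℕ, term ψ q (n + j) := rfl
  linarith

theorem sum_Icc_term_le_tailSum (hg : ClassM (gFun ψ p))
    (hsum : Summable fun j : ℕ => term ψ q (j + 1)) {n : ℕ} (hn : 1 ≤ n) (M : ℕ) :
    ∑ k ∈ Finset.Icc n M, term ψ q k ≤ tailSum ψ q n := by
  have e : ∑ k ∈ Finset.Icc n M, term ψ q k
      = ∑ j ∈ Finset.range (M + 1 - n), term ψ q (n + j) := by
    rw [← Finset.sum_Ico_eq_sum_range]; rfl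
  rw [e]
  exact (summable_term_add hsum n).sum_le_tsum _ fun j _ => term_nonneg hg (by omega)

theorem tendsto_sum_Icc_term (hsum : Summable fun j : ℕ => term ψ q (j + 1)) (n : ℕ) :
    Tendsto (fun M => ∑ k ∈ Finset.Icc n M, term ψ q k) atTop (𝓝 (tailSum ψ q n)) := by
  have e : ∀ M, ∑ k ∈ Finset.Icc n M, term ψ q k
      = ∑ j ∈ Finset.range (M + 1 - n), term ψ q (n + j) := by
    intro M
    rw [← Finset.sum_Ico_eq_sum_range]; rfl
  simp only [e]
  exact (summable_term_add hsum n).tendsto_sum_tsum_nat.comp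
    (tendsto_atTop_mono (fun M => by omega : ∀ M, M - n ≤ M + 1 - n) (tendsto_sub_atTop_nat n))

theorem tendsto_tailSum (ψ : ℝ → ℝ) (q : ℝ) :
    Tendsto (tailSum ψ q) atTop (𝓝 0) := by
  have h := tendsto_sum_nat_add (fun j => term ψ q j)
  change Tendsto (fun n => ∑' j : ℕ, term ψ q (n + j)) atTop (𝓝 0)
  simpa only [add_comm] using h

theorem tailSum_nonneg (hg : ClassM (gFun ψ p)) {n : ℕ} (hn : 1 ≤ n) : 0 ≤ tailSum ψ q n :=
  tsum_nonneg fun j => term_nonneg hg (by omega)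

end

/-! ### Uniqueness of Fourier series -/

theorem integrable_continuous_mul {u : Circ → ℂ} (hu : Integrable u) {g : Circ → ℂ}
    (hg : Continuous g) : Integrable fun t => g t * u t := by
  obtain ⟨C, hC⟩ := (isCompact_univ (X := Circ)).exists_bound_of_continuousOn hg.continuousOn
  exact hu.bdd_mul hg.aestronglyMeasurable (ae_of_all _ fun t => hC t (mem_univ t))

/-- An integrable function orthogonal to all characters is orthogonal to every continuous function,
by the density of trigonometric polynomials. -/
theorem integral_continuous_mul_eq_zero {u : Circ → ℂ} (hu : Integrable u)
    (h : ∀ k : ℤ, ∫ t : Circ, fourier k t * u t = 0) (g : C(Circ, ℂ)) :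
    ∫ t : Circ, g t * u t = 0 := by
  let L : C(Circ, ℂ) →L[ℂ] ℂ := LinearMap.mkContinuous
    { toFun := fun g => ∫ t : Circ, g t * u t
      map_add' := fun f g => by
        simp only [ContinuousMap.add_apply, add_mul]
        exact integral_add (integrable_continuous_mul hu f.continuous)
          (integrable_continuous_mul hu g.continuous)
      map_smul' := fun c g => by
        simp only [ContinuousMap.smul_apply, smul_eq_mul, mul_assoc, RingHom.id_apply]
        exact integral_const_mul _ _ }
    (∫ t : Circ, ‖u t‖) fun g => by
      rw [LinearMap.coe_mk, AddHom.coe_mk, ← integral_mul_const]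
      refine norm_integral_le_of_norm_le (hu.norm.mul_const _) (ae_of_all _ fun t => ?_)
      rw [norm_mul, mul_comm]
      gcongr
      exact g.norm_coe_le_norm t
  have hker : (⊤ : Submodule ℂ C(Circ, ℂ)) ≤ L.ker := by
    rw [← span_fourier_closure_eq_top]
    refine Submodule.topologicalClosure_minimal _ (Submodule.span_le.2 ?_) L.isClosed_ker
    rintro _ ⟨k, rfl⟩
    exact h k
  exact hker (Submodule.mem_top (x := g))

/-- The positive and negative parts of `u` are densities of finite measures that agree
on continuous functions, hence coincide. -/
theorem ae_eq_zero_of_forall_integral_continuous_mul {u : Circ → ℝ} (hu : Integrable u)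
    (h : ∀ g : Circ → ℝ, Continuous g → ∫ t : Circ, g t * u t = 0) : u =ᵐ[volume] 0 := by
  have hfin : ∀ v : Circ → ℝ, Integrable v →
      IsFiniteMeasure ((volume : Measure Circ).withDensity fun t => ENNReal.ofReal (v t)) :=
    fun v hv => isFiniteMeasure_withDensity_ofReal hv.2
  have hneg : Integrable (fun t => -u t) := hu.neg
  have h1 := hfin u hu
  have h2 := hfin _ hneg
  have hmeas : ∀ v : Circ → ℝ, Integrable v →
      AEMeasurable (fun t => ENNReal.ofReal (v t)) (volume : Measure Circ) :=
    fun v hv => hv.1.aemeasurable.ennreal_ofReal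
  have hint : ∀ v : Circ → ℝ, Integrable v → ∀ g : Circ → ℝ,
      ∫ t, g t ∂((volume : Measure Circ).withDensity fun t => ENNReal.ofReal (v t))
        = ∫ t : Circ, g t * max (v t) 0 := by
    intro v hv g
    rw [integral_withDensity_eq_integral_toReal_smul₀ (hmeas v hv)
      (ae_of_all _ fun t => ENNReal.ofReal_lt_top)]
    refine integral_congr_ae (ae_of_all _ fun t => ?_)
    simp [ENNReal.toReal_ofReal', mul_comm]
  have heq : (volume : Measure Circ).withDensity (fun t => ENNReal.ofReal (u t))
      = (volume : Measure Circ).withDensity (fun t => ENNReal.ofReal (-u t)) := by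
    refine ext_of_forall_integral_eq_of_IsFiniteMeasure fun g => ?_
    rw [hint u hu, hint _ hneg, ← sub_eq_zero, ← integral_sub]
    · refine (integral_congr_ae (ae_of_all _ fun t => ?_)).trans (h g g.continuous)
      rcases le_total (u t) 0 with h | h
      · rw [max_eq_right h, max_eq_left (by linarith)]; ring_nf
      · rw [max_eq_left h, max_eq_right (by linarith)]; ring_nf
    · exact hu.pos_part.bdd_mul g.continuous.aestronglyMeasurable
        (ae_of_all _ fun t => g.norm_coe_le_norm t)
    · exact hneg.pos_part.bdd_mul g.continuous.aestronglyMeasurable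
        (ae_of_all _ fun t => g.norm_coe_le_norm t)
  have hae := (withDensity_eq_iff (hmeas u hu) (hmeas _ hneg)
    (by rw [← lt_top_iff_ne_top]; simpa using h1.measure_univ_lt_top)).1 heq
  filter_upwards [hae] with t ht
  simp only [Pi.zero_apply]
  rcases lt_trichotomy (u t) 0 with h | h | h
  · rw [ENNReal.ofReal_of_nonpos h.le] at ht
    have := ENNReal.ofReal_eq_zero.1 ht.symm
    linarith
  · exact h
  · rw [ENNReal.ofReal_of_nonpos (p := -u t) (by linarith)] at ht
    have := ENNReal.ofReal_eq_zero.1 ht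
    linarith

/-- Uniqueness of Fourier series in `L_1`. -/
theorem ae_eq_zero_of_forall_fourier {u : Circ → ℂ} (hu : Integrable u)
    (h : ∀ k : ℤ, ∫ t : Circ, fourier k t * u t = 0) : u =ᵐ[volume] 0 := by
  have key : ∀ g : Circ → ℝ, Continuous g → ∫ t : Circ, (g t : ℂ) * u t = 0 := fun g hg =>
    integral_continuous_mul_eq_zero hu h ⟨fun t => (g t : ℂ), by fun_prop⟩
  have hre := ae_eq_zero_of_forall_integral_continuous_mul hu.re fun g hg => by
    have h1 := integral_re (𝕜 := ℂ)
      (integrable_continuous_mul hu (g := fun t => (g t : ℂ)) (by fun_prop))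
    rw [key g hg] at h1
    simpa using h1
  have him := ae_eq_zero_of_forall_integral_continuous_mul hu.im fun g hg => by
    have h1 := integral_im (𝕜 := ℂ)
      (integrable_continuous_mul hu (g := fun t => (g t : ℂ)) (by fun_prop))
    rw [key g hg] at h1
    simpa using h1
  filter_upwards [hre, him] with t h1 h2
  exact Complex.ext h1 h2

theorem integral_fourier_mul_fourier (j k : ℤ) :
    ∫ t : Circ, fourier (-j) t * fourier k t = if j = k then (2 * π : ℂ) else 0 := by
  have h := congrFun (fourierCoeff_fourier (T := 2 * π) k) j
  unfold fourierCoeff at h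
  rw [AddCircle.integral_haarAddCircle] at h
  simp only [smul_eq_mul, Complex.real_smul] at h
  have hπ : (π : ℂ) ≠ 0 := by exact_mod_cast Real.pi_ne_zero
  rw [Complex.ofReal_inv, inv_mul_eq_iff_eq_mul₀ (by simp [hπ])] at h
  rw [h]
  by_cases hjk : j = k
  · simp [hjk]
  · simp [hjk]

/-! ### Fourier coefficients and the upper bound -/

theorem fourier_sub (k : ℤ) (x t : Circ) :
    (fourier k (x - t) : ℂ) = fourier (-k) t * fourier k x := by
  rw [fourier_apply, fourier_apply, fourier_apply, smul_sub, sub_eq_add_neg, ← neg_smul,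
    AddCircle.toCircle_add, Circle.coe_mul, mul_comm]

theorem coeff_neg (f : Circ → ℝ) (k : ℤ) : coeff f (-k) = (starRingEnd ℂ) (coeff f k) := by
  rw [coeff_eq_integral, coeff_eq_integral, map_mul, ← integral_conj]
  congr 1
  · simp [map_ofNat]
  · congr 1
    ext t
    rw [map_mul, Complex.conj_ofReal, ← fourier_neg]

theorem norm_coeff_le (f : Circ → ℝ) (k : ℤ) :
    ‖coeff f k‖ ≤ 1 / (2 * π) * ∫ t : Circ, ‖f t‖ := by
  rw [coeff_eq_integral, norm_mul]
  have hπ := Real.pi_pos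
  have e : ‖(1 / (2 * π) : ℂ)‖ = 1 / (2 * π) := by
    have : (1 / (2 * π) : ℂ) = ((1 / (2 * π) : ℝ) : ℂ) := by push_cast; rfl
    rw [this, Complex.norm_real, Real.norm_of_nonneg (by positivity)]
  rw [e]
  refine mul_le_mul_of_nonneg_left ((norm_integral_le_integral_norm _).trans (le_of_eq ?_))
    (by positivity)
  refine integral_congr_ae (ae_of_all _ fun t => ?_)
  simp only [norm_mul, Complex.norm_real]
  rw [fourier_apply, Circle.norm_coe, one_mul]

/-- A frequency outside `γ` can be added at arbitrarily small cost, because the Fourier coefficients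
tend to zero. The claim is not immediate, as a larger `γ` need not give a smaller uniform error. -/
theorem bestOrth_succ_le {f : Circ → ℝ} (hf : Integrable f)
    (hlim : Tendsto (fun k : ℕ => coeff f k) atTop (𝓝 0)) (m : ℕ) :
    bestOrth (m + 1) ∞ f ≤ bestOrth m ∞ f := by
  refine le_iInf₂ fun γ hγ => ENNReal.le_of_forall_pos_le_add fun ε hε _ => ?_
  have h1 : ∀ᶠ k : ℕ in atTop, ‖coeff f k‖ ≤ ε :=
    (hlim.norm.eventually_lt_const (by simpa using hε)).mono fun k hk => hk.le
  have h2 : ∀ᶠ k : ℕ in atTop, (k : ℤ) ∉ γ := by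
    obtain ⟨b, hb⟩ := γ.bddAbove
    filter_upwards [eventually_gt_atTop b.toNat] with k hk hkγ
    have := hb hkγ
    omega
  obtain ⟨k, hk1, hk2⟩ := (h1.and h2).exists
  refine (iInf₂_le (insert (k : ℤ) γ) (by rw [Finset.card_insert_of_notMem hk2, hγ])).trans ?_
  have e : (fun x => (f x : ℂ) - partialSum f (insert (k : ℤ) γ) x)
      = (fun x => (f x : ℂ) - partialSum f γ x) - fun x => coeff f k * fourier (k : ℤ) x := by
    ext x
    simp only [partialSum, Finset.sum_insert hk2, Pi.sub_apply]
    ring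
  have hmeas : AEStronglyMeasurable (fun x => (f x : ℂ) - partialSum f γ x) volume := by
    have : Continuous (partialSum f γ) := by unfold partialSum; fun_prop
    exact hf.ofReal.1.sub this.aestronglyMeasurable
  have hmeas2 : AEStronglyMeasurable (fun x : Circ => coeff f k * fourier (k : ℤ) x) volume :=
    Continuous.aestronglyMeasurable (by fun_prop)
  rw [e]
  refine (eLpNorm_sub_le hmeas hmeas2 (by simp)).trans ?_
  gcongr
  rw [eLpNorm_exponent_top]
  refine (eLpNormEssSup_le_of_ae_bound (C := ε) (ae_of_all _ fun x => ?_)).trans (by simp)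
  rw [norm_mul, fourier_apply, Circle.norm_coe, mul_one]
  exact hk1

section
variable {p q : ℝ} {ψ : ℝ → ℝ} {β : ℝ} {f φ : Circ → ℝ}

theorem IsPsiBetaDeriv.coeff_eq (hψ : ClassM ψ) (h : IsPsiBetaDeriv ψ β f φ) {k : ℕ}
    (hk : 1 ≤ k) :
    coeff f k = Complex.exp (-(Complex.I * (β * π / 2 : ℝ))) * (ψ k * coeff φ k) := by
  have h1 := h.2.2 k (by omega)
  have h2 : (ψ k : ℂ) ≠ 0 := by
    exact_mod_cast (hψ.1 k (show (1 : ℝ) ≤ k by exact_mod_cast hk)).ne'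
  have h3 : ((k : ℤ).sign : ℝ) = 1 := by
    rw [Int.sign_eq_one_of_pos (by omega)]; simp
  have h4 : |((k : ℤ) : ℝ)| = k := by simp
  rw [h3, h4, mul_one] at h1
  rw [h1, Complex.exp_neg]
  have := Complex.exp_ne_zero (Complex.I * (β * π / 2 : ℝ))
  field_simp

theorem norm_exp_neg_I_mul (y : ℝ) : ‖Complex.exp (-(Complex.I * (y : ℝ)))‖ = 1 := by
  rw [Complex.norm_exp]; simp

theorem IsPsiBetaDeriv.tendsto_coeff (hψ : ClassM ψ) (h : IsPsiBetaDeriv ψ β f φ) :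
    Tendsto (fun k : ℕ => coeff f k) atTop (𝓝 0) := by
  have h1 : Tendsto (fun k : ℕ => ψ k * (1 / (2 * π) * ∫ t : Circ, ‖φ t‖)) atTop (𝓝 0) := by
    simpa using (hψ.2.2.2.comp tendsto_natCast_atTop_atTop).mul_const _
  refine squeeze_zero_norm' ?_ h1
  filter_upwards [eventually_ge_atTop 1] with k hk
  have hψk := hψ.1 k (show (1 : ℝ) ≤ k by exact_mod_cast hk)
  rw [h.coeff_eq hψ hk, norm_mul, norm_exp_neg_I_mul, one_mul, norm_mul, Complex.norm_real,
    Real.norm_of_nonneg hψk.le]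
  gcongr
  exact norm_coeff_le φ k

/-- The positive-frequency part of a partial sum of `f` is a convolution of `φ` with the kernel
`∑ ψ(k) e^{ikt}`, up to a unimodular factor. -/
theorem IsPsiBetaDeriv.sum_coeff_eq (hψ : ClassM ψ) (h : IsPsiBetaDeriv ψ β f φ) {n M : ℕ}
    (hn : 1 ≤ n) (x : Circ) :
    ∑ k ∈ Finset.Icc n M, coeff f k * fourier (k : ℤ) x
      = Complex.exp (-(Complex.I * (β * π / 2 : ℝ))) * ((1 / (2 * π) : ℂ) *
        ∫ t : Circ, expSum (fun k => ψ k) n M (x - t) * (φ t : ℂ)) := by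
  have hint : ∀ k ∈ Finset.Icc n M, Integrable fun t : Circ =>
      (ψ k : ℂ) * fourier (k : ℤ) x * (fourier (-(k : ℤ)) t * (φ t : ℂ)) := fun k _ =>
    (integrable_continuous_mul h.1.ofReal (by fun_prop)).const_mul _
  have e : ∀ t, expSum (fun k => ψ k) n M (x - t) * (φ t : ℂ)
      = ∑ k ∈ Finset.Icc n M, (ψ k : ℂ) * fourier (k : ℤ) x *
          (fourier (-(k : ℤ)) t * (φ t : ℂ)) := by
    intro t
    rw [expSum, Finset.sum_mul]
    refine Finset.sum_congr rfl fun k _ => ?_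
    rw [fourier_sub]; ring
  simp only [e]
  rw [integral_finsetSum _ hint, Finset.mul_sum, Finset.mul_sum]
  refine Finset.sum_congr rfl fun k hk => ?_
  rw [h.coeff_eq hψ (hn.trans (Finset.mem_Icc.1 hk).1), coeff_eq_integral, integral_const_mul]
  ring

theorem norm_integral_conv_le (hpq : p.HolderConjugate q) (hφ : Integrable φ)
    (hφ1 : eLpNorm φ (ENNReal.ofReal p) volume ≤ 1) {E : Circ → ℂ} (hE : Continuous E) (x : Circ) :
    ‖∫ t : Circ, E (x - t) * (φ t : ℂ)‖ ≤ (∫ t : Circ, ‖E t‖ ^ q) ^ (1 / q) := by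
  have hp0 := hpq.pos
  have hφm : MemLp (fun t => (φ t : ℂ)) (ENNReal.ofReal p) volume :=
    MemLp.ofReal ⟨hφ.1, hφ1.trans_lt ENNReal.one_lt_top⟩
  have hEc : Continuous fun t => E (x - t) := by fun_prop
  have hEm : MemLp (fun t => E (x - t)) (ENNReal.ofReal q) volume := by
    obtain ⟨C, hC⟩ := (isCompact_univ (X := Circ)).exists_bound_of_continuousOn hEc.continuousOn
    exact MemLp.of_bound hEc.aestronglyMeasurable C (ae_of_all _ fun t => hC t (mem_univ t))
  have h1 := integral_mul_norm_le_Lp_mul_Lq hpq hφm hEm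
  have h2 : (∫ t : Circ, ‖(φ t : ℂ)‖ ^ p) ^ (1 / p) ≤ 1 := by
    have h3 := hφm.eLpNorm_eq_integral_rpow_norm (by simpa using hp0) (by simp)
    have h4 : eLpNorm (fun t => (φ t : ℂ)) (ENNReal.ofReal p) volume ≤ 1 := by
      refine le_trans (le_of_eq ?_) hφ1
      exact eLpNorm_congr_norm_ae (ae_of_all _ fun t => by simp)
    rw [h3, ENNReal.toReal_ofReal hp0.le] at h4
    rw [one_div]
    exact ENNReal.ofReal_le_one.1 h4
  have h5 : ∫ t : Circ, ‖E (x - t)‖ ^ q = ∫ t : Circ, ‖E t‖ ^ q :=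
    integral_sub_left_eq_self (fun t => ‖E t‖ ^ q) volume x
  rw [h5] at h1
  calc ‖∫ t : Circ, E (x - t) * (φ t : ℂ)‖ ≤ ∫ t : Circ, ‖E (x - t) * (φ t : ℂ)‖ :=
        norm_integral_le_integral_norm _
    _ = ∫ t : Circ, ‖(φ t : ℂ)‖ * ‖E (x - t)‖ := by simp only [norm_mul, mul_comm]
    _ ≤ _ := h1
    _ ≤ 1 * (∫ t : Circ, ‖E t‖ ^ q) ^ (1 / q) := by
        refine mul_le_mul_of_nonneg_right h2 (Real.rpow_nonneg (integral_nonneg fun t => ?_) _)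
        positivity
    _ = _ := one_mul _

theorem rpow_norm_expSum_psi_le (hpq : 1 / p + 1 / q = 1) (hq : 1 < q) (hψ : ClassM ψ)
    (hg : ClassM (gFun ψ p)) (hα : q < lowerAlpha (gFun ψ p) 1)
    (hsum : Summable fun j : ℕ => term ψ q (j + 1)) {n M : ℕ} (hn : 1 ≤ n) (hnM : n ≤ M) :
    (∫ t : Circ, ‖expSum (fun k => ψ k) n M t‖ ^ q) ^ (1 / q)
      ≤ xi q * ((1 + q / lowerAlpha (gFun ψ p) 1) * tailSum ψ q n) ^ (1 / q) := by
  have hcast : ∀ {k : ℕ}, n ≤ k → (k : ℝ) ∈ Ici (1 : ℝ) := fun {k} hk => by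
    simpa using hn.trans hk
  refine rpow_norm_expSum_le hq hn hnM (fun k hk => ?_) (fun k hk => (hψ.1 k (hcast hk)).le)
    (sum_Icc_term_le_tailSum hg hsum hn M) ?_
  · exact hψ.antitoneOn (hcast hk) (hcast (by omega)) (by simp)
  · refine le_trans (le_of_eq ?_) (gFun_rpow_le_tailSum hpq hq hg hα hsum hn)
    have hn0 : (0 : ℝ) < n := by exact_mod_cast hn
    have h1 := term_eq_gFun_rpow_div hpq hq hg hn
    rw [eq_div_iff hn0.ne', term, mul_assoc, ← Real.rpow_add_one hn0.ne'] at h1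
    rw [← h1]; ring_nf

/-- The symmetric partial sum `∑_{|k| ≤ m} f̂(k) e^{ikx}`. It has `2m + 1` terms. -/
noncomputable def symSum (f : Circ → ℝ) (m : ℕ) : Circ → ℂ :=
  partialSum f (Finset.Icc (-(m : ℤ)) m)

theorem continuous_symSum (f : Circ → ℝ) (m : ℕ) : Continuous (symSum f m) := by
  unfold symSum partialSum; fun_prop

theorem symSum_succ (f : Circ → ℝ) (m : ℕ) (x : Circ) :
    symSum f (m + 1) x = symSum f m x + (coeff f (m + 1 : ℕ) * fourier ((m + 1 : ℕ) : ℤ) x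
      + coeff f (-((m + 1 : ℕ) : ℤ)) * fourier (-((m + 1 : ℕ) : ℤ)) x) := by
  have e : Finset.Icc (-((m + 1 : ℕ) : ℤ)) ((m + 1 : ℕ) : ℤ)
      = insert ((m + 1 : ℕ) : ℤ) (insert (-((m + 1 : ℕ) : ℤ)) (Finset.Icc (-(m : ℤ)) m)) := by
    ext j; simp only [Finset.mem_insert, Finset.mem_Icc]; omega
  unfold symSum partialSum
  rw [e, Finset.sum_insert (by simp only [Finset.mem_insert, Finset.mem_Icc]; omega),
    Finset.sum_insert (by simp only [Finset.mem_Icc]; omega)]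
  ring

/-- Since `f` is real, the negative frequencies contribute the complex conjugate of what the positive
ones contribute. -/
theorem symSum_sub_symSum (f : Circ → ℝ) {m M : ℕ} (hmM : m ≤ M) (x : Circ) :
    symSum f M x - symSum f m x
      = ∑ k ∈ Finset.Icc (m + 1) M, coeff f k * fourier (k : ℤ) x
        + (starRingEnd ℂ) (∑ k ∈ Finset.Icc (m + 1) M, coeff f k * fourier (k : ℤ) x) := by
  induction M, hmM using Nat.le_induction with
  | base => simp
  | succ M hM ih =>
    rw [Finset.sum_Icc_succ_top (by omega), map_add, symSum_succ, coeff_neg, fourier_neg, map_mul]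
    linear_combination ih

theorem norm_symSum_sub_le (hpq : p.HolderConjugate q) (hψ : ClassM ψ)
    (hg : ClassM (gFun ψ p)) (hα : q < lowerAlpha (gFun ψ p) 1)
    (hsum : Summable fun j : ℕ => term ψ q (j + 1)) (h : IsPsiBetaDeriv ψ β f φ)
    (hφ1 : eLpNorm φ (ENNReal.ofReal p) volume ≤ 1) {m M : ℕ} (hmM : m ≤ M) (x : Circ) :
    ‖symSum f M x - symSum f m x‖ ≤ 1 / π *
      (xi q * ((1 + q / lowerAlpha (gFun ψ p) 1) * tailSum ψ q (m + 1)) ^ (1 / q)) := by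
  have hπ := Real.pi_pos
  have hpq' : 1 / p + 1 / q = 1 := by simpa using hpq.inv_add_inv_eq_one
  have hq := hpq.symm.lt
  have hR : 0 ≤ xi q * ((1 + q / lowerAlpha (gFun ψ p) 1) * tailSum ψ q (m + 1)) ^ (1 / q) := by
    have := xi_pos hq
    have := tailSum_nonneg (q := q) hg (show 1 ≤ m + 1 by omega)
    have : 0 < lowerAlpha (gFun ψ p) 1 := by linarith
    positivity
  rcases hmM.eq_or_lt with rfl | hlt
  · simp only [sub_self, norm_zero]; positivity
  rw [symSum_sub_symSum f hmM, h.sum_coeff_eq hψ (by omega)]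
  refine (norm_add_le _ _).trans ?_
  rw [Complex.norm_conj, norm_mul, norm_exp_neg_I_mul, one_mul, norm_mul]
  have e : ‖(1 / (2 * π) : ℂ)‖ = 1 / (2 * π) := by
    have : (1 / (2 * π) : ℂ) = ((1 / (2 * π) : ℝ) : ℂ) := by push_cast; rfl
    rw [this, Complex.norm_real, Real.norm_of_nonneg (by positivity)]
  rw [e, ← two_mul, ← mul_assoc]
  have e2 : 2 * (1 / (2 * π)) = 1 / π := by field_simp
  rw [e2]
  gcongr
  exact (norm_integral_conv_le hpq h.1 hφ1 (continuous_expSum _ _ _) x).trans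
    (rpow_norm_expSum_psi_le hpq' hq hψ hg hα hsum (by omega) hlt)

theorem integral_fourier_mul_symSum (f : Circ → ℝ) {k : ℤ} {m : ℕ} (hk : k.natAbs ≤ m) :
    ∫ t : Circ, fourier (-k) t * symSum f m t = ∫ t : Circ, fourier (-k) t * (f t : ℂ) := by
  have hmem : k ∈ Finset.Icc (-(m : ℤ)) m := by rw [Finset.mem_Icc]; omega
  have e : ∀ t : Circ, fourier (-k) t * symSum f m t
      = ∑ j ∈ Finset.Icc (-(m : ℤ)) m, coeff f j * (fourier (-k) t * fourier j t) := by
    intro t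
    rw [symSum, partialSum, Finset.mul_sum]
    exact Finset.sum_congr rfl fun j _ => by ring
  simp only [e]
  rw [integral_finsetSum _ fun j _ =>
    (Continuous.integrable_of_hasCompactSupport (by fun_prop) (HasCompactSupport.of_compactSpace _))]
  simp only [integral_const_mul, integral_fourier_mul_fourier]
  simp only [mul_ite, mul_zero]
  rw [Finset.sum_ite_eq, if_pos hmem, coeff_eq_integral]
  have hπ : (π : ℂ) ≠ 0 := by exact_mod_cast Real.pi_ne_zero
  field_simp

/-- If the symmetric partial sums are uniformly Cauchy, their limit is a continuous function with the
Fourier coefficients of `f`, hence equals `f` almost everywhere. -/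
theorem ae_norm_sub_symSum_le (hf : Integrable f) {B : ℕ → ℝ} (hB : Tendsto B atTop (𝓝 0))
    (h : ∀ m M : ℕ, m ≤ M → ∀ x, ‖symSum f M x - symSum f m x‖ ≤ B m) :
    ∀ᵐ x : Circ, ∀ m, ‖(f x : ℂ) - symSum f m x‖ ≤ B m := by
  have hlim : ∀ x, ∃ y, Tendsto (fun m => symSum f m x) atTop (𝓝 y) := fun x => by
    refine cauchySeq_tendsto_of_complete (cauchySeq_of_le_tendsto_0 (fun m => 2 * B m) ?_ ?_)
    · intro m m' N hm hm'
      have h1 := h N m hm x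
      have h2 := h N m' hm' x
      rw [dist_eq_norm]
      have := norm_sub_le (symSum f m x - symSum f N x) (symSum f m' x - symSum f N x)
      rw [sub_sub_sub_cancel_right] at this
      linarith
    · simpa using hB.const_mul 2
  choose s hs using hlim
  have hsB : ∀ m x, ‖s x - symSum f m x‖ ≤ B m := fun m x =>
    le_of_tendsto ((hs x).sub_const _).norm
      ((eventually_ge_atTop m).mono fun M hM => h m M hM x)
  have hunif : TendstoUniformly (fun m => symSum f m) s atTop := by
    rw [Metric.tendstoUniformly_iff]
    intro ε hε
    filter_upwards [hB.eventually_lt_const hε] with m hm x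
    rw [dist_eq_norm]
    exact (hsB m x).trans_lt hm
  have hcont : Continuous s :=
    hunif.continuous (Frequently.of_forall fun m => continuous_symSum f m)
  have hci : ∀ {g : Circ → ℂ}, Continuous g → Integrable g := fun hg =>
    hg.integrable_of_hasCompactSupport (HasCompactSupport.of_compactSpace _)
  have hzero : ∀ k : ℤ, ∫ t : Circ, fourier k t * ((f t : ℂ) - s t) = 0 := by
    intro k
    have hbound : ∀ᶠ m : ℕ in atTop,
        ‖∫ t : Circ, fourier k t * ((f t : ℂ) - s t)‖ ≤ B m * (2 * π) := by
      filter_upwards [eventually_ge_atTop k.natAbs] with m hm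
      have h1 := integral_fourier_mul_symSum f (k := -k) (m := m) (by simpa using hm)
      rw [neg_neg] at h1
      have hi1 : Integrable fun t : Circ => fourier k t * (f t : ℂ) :=
        integrable_continuous_mul hf.ofReal (by fun_prop)
      have hi2 : Integrable fun t : Circ => fourier k t * s t := hci (by fun_prop)
      have hi3 : Integrable fun t : Circ => fourier k t * symSum f m t :=
        hci ((by fun_prop : Continuous fun t : Circ => (fourier k t : ℂ)).mul
          (continuous_symSum f m))
      have e : ∫ t : Circ, fourier k t * ((f t : ℂ) - s t)
          = ∫ t : Circ, fourier k t * (symSum f m t - s t) := by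
        simp only [mul_sub]
        rw [integral_sub hi1 hi2, integral_sub hi3 hi2, h1]
      rw [e]
      refine (norm_integral_le_of_norm_le_const (C := B m) (ae_of_all _ fun t => ?_)).trans
        (le_of_eq ?_)
      · rw [norm_mul, fourier_apply, Circle.norm_coe, one_mul, norm_sub_rev]
        exact hsB m t
      · rw [measureReal_def, AddCircle.measure_univ, ENNReal.toReal_ofReal Real.two_pi_pos.le]
    have := ge_of_tendsto (hB.mul_const (2 * π)) hbound
    rw [zero_mul] at this
    exact norm_le_zero_iff.1 this
  filter_upwards [ae_eq_zero_of_forall_fourier (hf.ofReal.sub (hci hcont)) hzero] with x hx m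
  have : (f x : ℂ) = s x := sub_eq_zero.1 hx
  rw [this]
  exact hsB m x

/-- The upper bound, obtained with the symmetric set `|k| ≤ n - 1`. -/
theorem bestOrthClass_le (hpq : p.HolderConjugate q) (hψ : ClassM ψ)
    (hg : ClassM (gFun ψ p)) (hα : q < lowerAlpha (gFun ψ p) 1)
    (hsum : Summable fun j : ℕ => term ψ q (j + 1)) {n : ℕ} (hn : 1 ≤ n) (β : ℝ) :
    bestOrthClass (2 * n - 1) ∞ (psiClass ψ β (ENNReal.ofReal p))
      ≤ ENNReal.ofReal (constUpper ψ p q * tailSum ψ q n ^ (1 / q)) := by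
  refine iSup₂_le fun f hf => ?_
  obtain ⟨hfi, φ, hφ, hφ1⟩ := hf
  have hq := hpq.symm.lt
  have hA : 0 < lowerAlpha (gFun ψ p) 1 := by linarith
  obtain ⟨m, rfl⟩ : ∃ m, n = m + 1 := ⟨n - 1, by omega⟩
  have hB : Tendsto (fun m : ℕ => 1 / π *
      (xi q * ((1 + q / lowerAlpha (gFun ψ p) 1) * tailSum ψ q (m + 1)) ^ (1 / q)))
      atTop (𝓝 0) := by
    have h1 := (((tendsto_tailSum ψ q).comp (tendsto_add_atTop_nat 1)).const_mul
      (1 + q / lowerAlpha (gFun ψ p) 1)).rpow_const (p := 1 / q) (Or.inr (by positivity))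
    rw [mul_zero, Real.zero_rpow (by positivity)] at h1
    simpa using (h1.const_mul (xi q)).const_mul (1 / π)
  refine (iInf₂_le (Finset.Icc (-(m : ℤ)) m) (by rw [Int.card_Icc]; omega)).trans ?_
  rw [eLpNorm_exponent_top]
  refine eLpNormEssSup_le_of_ae_bound ?_
  filter_upwards [ae_norm_sub_symSum_le hfi hB fun m M hmM x =>
    norm_symSum_sub_le hpq hψ hg hα hsum hφ hφ1 hmM x] with x hx
  refine (hx m).trans (le_of_eq ?_)
  have hT := tailSum_nonneg (q := q) hg hn
  rw [Real.mul_rpow (by positivity) hT, constUpper]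
  have : 1 + q / lowerAlpha (gFun ψ p) 1
      = (q + lowerAlpha (gFun ψ p) 1) / lowerAlpha (gFun ψ p) 1 := by field_simp; ring
  rw [this]; ring

theorem bestOrthClass_succ_le (hψ : ClassM ψ) (β : ℝ) (r : ℝ≥0∞) (m : ℕ) :
    bestOrthClass (m + 1) ∞ (psiClass ψ β r) ≤ bestOrthClass m ∞ (psiClass ψ β r) :=
  iSup₂_mono fun _ hf => by
    obtain ⟨hfi, φ, hφ, -⟩ := hf
    exact bestOrth_succ_le hfi (hφ.tendsto_coeff hψ) m

end

/-! ### The lower bound -/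

theorem enorm_le_eLpNorm_top_of_continuous {h : Circ → ℂ} (hh : Continuous h) (x : Circ) :
    ‖h x‖ₑ ≤ eLpNorm h ∞ volume := by
  rw [eLpNorm_exponent_top]
  have hd := Measure.dense_of_ae (ae_le_eLpNormEssSup (f := h) (μ := (volume : Measure Circ)))
  have hc : IsClosed {y | ‖h y‖ₑ ≤ eLpNormEssSup h volume} :=
    isClosed_le hh.enorm continuous_const
  have : x ∈ closure {y | ‖h y‖ₑ ≤ eLpNormEssSup h volume} := hd x
  rwa [hc.closure_eq] at this

theorem sum_natAbs_le {e : ℕ → ℝ} (he : ∀ k, 0 ≤ e k) {S : Finset ℕ} (hS : ∀ k ∉ S, e k = 0)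
    (γ : Finset ℤ) : ∑ k ∈ γ, e k.natAbs ≤ 2 * ∑ k ∈ S, e k := by
  have key : ∀ T : Finset ℕ, ∑ k ∈ T, e k ≤ ∑ k ∈ S, e k := fun T =>
    calc ∑ k ∈ T, e k = ∑ k ∈ T ∩ S, e k :=
          (Finset.sum_subset Finset.inter_subset_left fun k hkT hk => hS k fun hkS =>
            hk (Finset.mem_inter.2 ⟨hkT, hkS⟩)).symm
      _ ≤ ∑ k ∈ S, e k :=
          Finset.sum_le_sum_of_subset_of_nonneg Finset.inter_subset_right fun k _ _ => he k
  rw [← Finset.sum_filter_add_sum_filter_not γ (fun k => 0 ≤ k), two_mul]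
  refine add_le_add ?_ ?_
  · rw [← Finset.sum_image (f := e) (g := Int.natAbs)]
    · exact key _
    · intro a ha b hb hab
      simp only [Finset.coe_filter, mem_ofPred_eq] at ha hb
      omega
  · rw [← Finset.sum_image (f := e) (g := Int.natAbs)]
    · exact key _
    · intro a ha b hb hab
      simp only [Finset.coe_filter, mem_ofPred_eq] at ha hb
      omega

/-- Among all sets of `2n` integers the largest share of a symmetric family that vanishes for
`|k| < n` and is nonincreasing afterwards is carried by `n ≤ |k| < 2n`. -/
theorem sum_natAbs_le_of_card {c : ℕ → ℝ} {n M : ℕ} (hn : 1 ≤ n) (hM : 2 * n ≤ M)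
    (hc : ∀ k, n ≤ k → 0 ≤ c k) (hanti : ∀ j k, n ≤ j → j ≤ k → c k ≤ c j)
    {γ : Finset ℤ} (hγ : γ.card = 2 * n) :
    ∑ k ∈ γ, (if k.natAbs ∈ Finset.Icc n M then c k.natAbs else 0)
      ≤ 2 * ∑ k ∈ Finset.Ico n (2 * n), c k := by
  -- Every value outside `n ≤ |k| < 2n` is at most `δ`, every value inside is at least `δ`.
  set δ := c (2 * n - 1) with hδ
  have hδ0 : 0 ≤ δ := hc _ (by omega)
  have h1 := sum_natAbs_le (e := fun k => if k ∈ Finset.Ico n (2 * n) then c k - δ else 0)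
    (S := Finset.Ico n (2 * n)) (fun k => by
      split_ifs with h
      · rw [Finset.mem_Ico] at h
        linarith [hanti k (2 * n - 1) h.1 (by omega)]
      · exact le_rfl) (fun k hk => by rw [if_neg hk]) γ
  have h2 : ∑ k ∈ γ, ((if k.natAbs ∈ Finset.Icc n M then c k.natAbs else 0) - δ)
      ≤ ∑ k ∈ γ, if k.natAbs ∈ Finset.Ico n (2 * n) then c k.natAbs - δ else 0 := by
    refine Finset.sum_le_sum fun k _ => ?_
    by_cases h3 : k.natAbs ∈ Finset.Icc n M
    · by_cases h4 : k.natAbs ∈ Finset.Ico n (2 * n)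
      · rw [if_pos h3, if_pos h4]
      · rw [if_pos h3, if_neg h4]
        simp only [Finset.mem_Icc, Finset.mem_Ico] at h3 h4
        linarith [hanti (2 * n - 1) k.natAbs (by omega) (by omega)]
    · have h4 : k.natAbs ∉ Finset.Ico n (2 * n) := by
        simp only [Finset.mem_Icc, Finset.mem_Ico] at h3 ⊢; omega
      rw [if_neg h3, if_neg h4]; linarith
  rw [Finset.sum_sub_distrib, Finset.sum_const, hγ, nsmul_eq_mul] at h2
  have h3 : ∑ k ∈ Finset.Ico n (2 * n), (if k ∈ Finset.Ico n (2 * n) then c k - δ else 0)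
      = ∑ k ∈ Finset.Ico n (2 * n), c k - n * δ := by
    rw [Finset.sum_congr rfl fun k hk => if_pos hk, Finset.sum_sub_distrib, Finset.sum_const,
      Nat.card_Ico, nsmul_eq_mul, show 2 * n - n = n by omega]
  rw [h3] at h1
  have h4 := h2.trans h1
  push_cast at h4
  linarith

theorem coeff_re_mul_expSum (w : ℂ) (a : ℕ → ℝ) {n : ℕ} (hn : 1 ≤ n) (M j : ℕ) :
    coeff (fun t => (w * expSum a n M t).re) j
      = if j ∈ Finset.Icc n M then w * a j / 2 else 0 := by
  have e : ∀ t : Circ, fourier (-(j : ℤ)) t * (((w * expSum a n M t).re : ℝ) : ℂ)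
      = ∑ k ∈ Finset.Icc n M, (w * a k / 2 * (fourier (-(j : ℤ)) t * fourier (k : ℤ) t)
          + (starRingEnd ℂ) w * a k / 2 * (fourier (-(j : ℤ)) t * fourier (-(k : ℤ)) t)) := by
    intro t
    rw [Complex.re_eq_add_conj, map_mul, expSum, map_sum, Finset.mul_sum, Finset.mul_sum,
      ← Finset.sum_add_distrib, Finset.sum_div, Finset.mul_sum]
    refine Finset.sum_congr rfl fun k _ => ?_
    rw [map_mul, Complex.conj_ofReal, ← fourier_neg]
    ring
  have hci : ∀ {g : Circ → ℂ}, Continuous g → Integrable g := fun hg =>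
    hg.integrable_of_hasCompactSupport (HasCompactSupport.of_compactSpace _)
  have h1 : ∀ k ∈ Finset.Icc n M, ∫ t : Circ,
      (w * a k / 2 * (fourier (-(j : ℤ)) t * fourier (k : ℤ) t)
          + (starRingEnd ℂ) w * a k / 2 * (fourier (-(j : ℤ)) t * fourier (-(k : ℤ)) t))
      = if j = k then w * a k / 2 * (2 * π) else 0 := by
    intro k hk
    have hk1 := (Finset.mem_Icc.1 hk).1
    rw [integral_add (hci (by fun_prop)) (hci (by fun_prop)), integral_const_mul,
      integral_const_mul, integral_fourier_mul_fourier, integral_fourier_mul_fourier,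
      if_neg (show ¬ (j : ℤ) = -(k : ℤ) by omega)]
    simp only [Nat.cast_inj, mul_zero, add_zero, mul_ite]
  rw [coeff_eq_integral]
  simp only [e]
  rw [integral_finsetSum _ fun k _ => hci (by fun_prop), Finset.sum_congr rfl h1,
    Finset.sum_ite_eq]
  have hπ : (π : ℂ) ≠ 0 := by exact_mod_cast Real.pi_ne_zero
  split_ifs
  · field_simp
  · simp

section
variable {p q : ℝ} {ψ : ℝ → ℝ}

/-- The coefficients `ψ^{q-1}(k) k^{q-2}`: the sequence for which Hölder's inequality between the
weighted `ℓ_p` and `ℓ_q` norms, with the weights of the Hardy–Littlewood bound, is an equality. -/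
noncomputable def dualCoeff (ψ : ℝ → ℝ) (q : ℝ) (k : ℕ) : ℝ := ψ k ^ (q - 1) * (k : ℝ) ^ (q - 2)

theorem dualCoeff_mul_psi (hψ : ClassM ψ) {k : ℕ} (hk : 1 ≤ k) :
    dualCoeff ψ q k * ψ k = term ψ q k := by
  have h := hψ.1 k (show (1 : ℝ) ≤ k by exact_mod_cast hk)
  rw [dualCoeff, term, mul_right_comm, ← Real.rpow_add_one h.ne', sub_add_cancel]

theorem dualCoeff_nonneg (hψ : ClassM ψ) {k : ℕ} (hk : 1 ≤ k) : 0 ≤ dualCoeff ψ q k := by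
  have h := hψ.1 k (show (1 : ℝ) ≤ k by exact_mod_cast hk)
  unfold dualCoeff; positivity

theorem dualCoeff_rpow_mul (hpq : p.HolderConjugate q) (hψ : ClassM ψ) {k : ℕ} (hk : 1 ≤ k) :
    dualCoeff ψ q k ^ p * (k : ℝ) ^ (p - 2) = term ψ q k := by
  have h := hψ.1 k (show (1 : ℝ) ≤ k by exact_mod_cast hk)
  have hk0 : (0 : ℝ) < k := by exact_mod_cast hk
  have h1 := hpq.mul_eq_add
  rw [dualCoeff, term, Real.mul_rpow (by positivity) (by positivity), ← Real.rpow_mul h.le,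
    ← Real.rpow_mul hk0.le, mul_assoc, ← Real.rpow_add hk0]
  congr 2 <;> linarith

theorem dualCoeff_eq (hpq : p.HolderConjugate q) (hψ : ClassM ψ) {k : ℕ} (hk : 1 ≤ k) :
    dualCoeff ψ q k = gFun ψ p k ^ (q - 1) * (k : ℝ) ^ (-(1 / q)) := by
  have h := hψ.1 k (show (1 : ℝ) ≤ k by exact_mod_cast hk)
  have hk0 : (0 : ℝ) < k := by exact_mod_cast hk
  have hq := hpq.symm.pos
  rw [dualCoeff, gFun, Real.mul_rpow h.le (by positivity), ← Real.rpow_mul hk0.le, mul_assoc,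
    ← Real.rpow_add hk0]
  congr 2
  have h1 : 1 / p = 1 - 1 / q := by
    have := hpq.inv_add_inv_eq_one
    rw [one_div, one_div]; linarith
  rw [h1]
  field_simp
  ring

theorem dualCoeff_antitone (hpq : p.HolderConjugate q) (hψ : ClassM ψ) (hg : ClassM (gFun ψ p))
    {j k : ℕ} (hj : 1 ≤ j) (hjk : j ≤ k) : dualCoeff ψ q k ≤ dualCoeff ψ q j := by
  have hj1 : (1 : ℝ) ≤ j := by exact_mod_cast hj
  have hjk' : (j : ℝ) ≤ k := by exact_mod_cast hjk
  have hq := hpq.symm.lt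
  rw [dualCoeff_eq hpq hψ hj, dualCoeff_eq hpq hψ (hj.trans hjk)]
  have h1 : gFun ψ p k ≤ gFun ψ p j := hg.antitoneOn hj1 (hj1.trans hjk') hjk'
  have h2 : 0 < gFun ψ p k := hg.1 _ (hj1.trans hjk')
  have h3 : (k : ℝ) ^ (-(1 / q)) ≤ (j : ℝ) ^ (-(1 / q)) :=
    Real.rpow_le_rpow_of_nonpos (by linarith) hjk' (by simp; linarith)
  have h4 : gFun ψ p k ^ (q - 1) ≤ gFun ψ p j ^ (q - 1) :=
    Real.rpow_le_rpow h2.le h1 (by linarith)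
  have h5 := h2.trans_le h1
  gcongr

theorem term_antitone (hpq : p.HolderConjugate q) (hψ : ClassM ψ) (hg : ClassM (gFun ψ p))
    {j k : ℕ} (hj : 1 ≤ j) (hjk : j ≤ k) : term ψ q k ≤ term ψ q j := by
  have hj1 : (1 : ℝ) ≤ j := by exact_mod_cast hj
  have hjk' : (j : ℝ) ≤ k := by exact_mod_cast hjk
  rw [← dualCoeff_mul_psi hψ hj, ← dualCoeff_mul_psi hψ (hj.trans hjk)]
  exact mul_le_mul (dualCoeff_antitone hpq hψ hg hj hjk)
    (hψ.antitoneOn hj1 (hj1.trans hjk') hjk') (hψ.1 _ (hj1.trans hjk')).le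
    (dualCoeff_nonneg hψ hj)

theorem rpow_norm_expSum_dualCoeff_le (hpq : p.HolderConjugate q) (hψ : ClassM ψ)
    (hg : ClassM (gFun ψ p)) (hα : q < lowerAlpha (gFun ψ p) 1)
    (hsum : Summable fun j : ℕ => term ψ q (j + 1)) {n M : ℕ} (hn : 1 ≤ n) (hnM : n ≤ M) :
    (∫ t : Circ, ‖expSum (dualCoeff ψ q) n M t‖ ^ p) ^ (1 / p)
      ≤ xi p * ((1 + q / lowerAlpha (gFun ψ p) 1) * tailSum ψ q n) ^ (1 / p) := by
  have hpq' : 1 / p + 1 / q = 1 := by simpa using hpq.inv_add_inv_eq_one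
  refine rpow_norm_expSum_le hpq.lt hn hnM
    (fun k hk => dualCoeff_antitone hpq hψ hg (hn.trans hk) (by omega))
    (fun k hk => dualCoeff_nonneg hψ (hn.trans hk)) ?_ ?_
  · rw [Finset.sum_congr rfl fun k hk =>
      dualCoeff_rpow_mul hpq hψ (hn.trans (Finset.mem_Icc.1 hk).1)]
    exact sum_Icc_term_le_tailSum hg hsum hn M
  · refine le_trans (le_of_eq ?_) (gFun_rpow_le_tailSum hpq' hpq.symm.lt hg hα hsum hn)
    have hn0 : (0 : ℝ) < n := by exact_mod_cast hn
    have h1 := term_eq_gFun_rpow_div hpq' hpq.symm.lt hg hn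
    rw [eq_div_iff hn0.ne', ← dualCoeff_rpow_mul hpq hψ hn, mul_assoc,
      ← Real.rpow_add_one hn0.ne'] at h1
    rw [← h1]; ring_nf

/-- The extremal pair: `∑ b_k ψ(k) cos kx` has the derivative `∑ b_k cos(kx + βπ/2)`, whatever `β`. -/
theorem isPsiBetaDeriv_re_expSum (hψ : ClassM ψ) (β l : ℝ) {n : ℕ} (hn : 1 ≤ n) (M : ℕ) :
    IsPsiBetaDeriv ψ β (fun t => ((l : ℂ) * expSum (term ψ q) n M t).re)
      (fun t => ((l * Complex.exp (Complex.I * (β * π / 2 : ℝ)) : ℂ)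
        * expSum (dualCoeff ψ q) n M t).re) := by
  have hpos : ∀ j : ℕ, 1 ≤ j →
      coeff (fun t => ((l * Complex.exp (Complex.I * (β * π / 2 : ℝ)) : ℂ)
          * expSum (dualCoeff ψ q) n M t).re) j
        = coeff (fun t => ((l : ℂ) * expSum (term ψ q) n M t).re) j / (ψ j : ℂ)
          * Complex.exp (Complex.I * (β * π / 2 : ℝ)) := by
    intro j hj
    have h2 : (ψ j : ℂ) ≠ 0 := by
      exact_mod_cast (hψ.1 j (show (1 : ℝ) ≤ j by exact_mod_cast hj)).ne'
    rw [coeff_re_mul_expSum _ _ hn, coeff_re_mul_expSum _ _ hn]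
    split_ifs
    · rw [← dualCoeff_mul_psi hψ hj]; push_cast; field_simp
    · simp
  refine ⟨?_, ?_, fun k hk => ?_⟩
  · have := continuous_expSum (dualCoeff ψ q) n M
    exact Continuous.integrable_of_hasCompactSupport (by fun_prop)
      (HasCompactSupport.of_compactSpace _)
  · have := coeff_re_mul_expSum (l * Complex.exp (Complex.I * (β * π / 2 : ℝ)))
      (dualCoeff ψ q) hn M 0
    rw [if_neg (by rw [Finset.mem_Icc]; omega)] at this
    exact_mod_cast this
  · obtain ⟨j, rfl | rfl⟩ := k.eq_nat_or_neg
    · have hj : 1 ≤ j := by omega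
      rw [hpos j hj, Int.sign_eq_one_of_pos (by omega)]
      simp
    · have hj : 1 ≤ j := by omega
      rw [coeff_neg, coeff_neg, hpos j hj, Int.sign_eq_neg_one_of_neg (by omega), map_mul, map_div₀,
        Complex.conj_ofReal, ← Complex.exp_conj]
      simp [map_ofNat]

/-- The truncated lower bound. All coefficients of the test function are nonnegative, so the value of
the remainder at `0` is the sum of the coefficients that `γ` misses. -/
theorem ofReal_mul_sum_term_le (hpq : p.HolderConjugate q) (hψ : ClassM ψ)
    (hg : ClassM (gFun ψ p)) (hα : q < lowerAlpha (gFun ψ p) 1)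
    (hsum : Summable fun j : ℕ => term ψ q (j + 1)) {n M : ℕ} (hn : 1 ≤ n) (hM : 2 * n ≤ M)
    (β : ℝ) {l : ℝ} (hl0 : 0 ≤ l)
    (hl : l * (xi p * ((1 + q / lowerAlpha (gFun ψ p) 1) * tailSum ψ q n) ^ (1 / p)) ≤ 1) :
    ENNReal.ofReal (l * ∑ k ∈ Finset.Icc (2 * n) M, term ψ q k)
      ≤ bestOrthClass (2 * n) ∞ (psiClass ψ β (ENNReal.ofReal p)) := by
  have hp := hpq.pos
  set f : Circ → ℝ := fun t => ((l : ℂ) * expSum (term ψ q) n M t).re with hf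
  set φ : Circ → ℝ := fun t => ((l * Complex.exp (Complex.I * (β * π / 2 : ℝ)) : ℂ)
        * expSum (dualCoeff ψ q) n M t).re with hφ
  have hfc : Continuous f := by
    have := continuous_expSum (term ψ q) n M
    fun_prop
  have hφ1 : eLpNorm φ (ENNReal.ofReal p) volume ≤ 1 := by
    have hE : Continuous fun t => (l : ℂ) * expSum (dualCoeff ψ q) n M t := by
      have := continuous_expSum (dualCoeff ψ q) n M
      fun_prop
    have h1 : eLpNorm φ (ENNReal.ofReal p) volume
        ≤ eLpNorm (fun t => (l : ℂ) * expSum (dualCoeff ψ q) n M t) (ENNReal.ofReal p) volume := by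
      refine eLpNorm_mono fun t => ?_
      rw [Real.norm_eq_abs]
      refine (Complex.abs_re_le_norm _).trans (le_of_eq ?_)
      rw [mul_right_comm, norm_mul, Complex.norm_exp]
      simp
    have hm : MemLp (fun t => (l : ℂ) * expSum (dualCoeff ψ q) n M t)
        (ENNReal.ofReal p) volume := by
      obtain ⟨C, hC⟩ := (isCompact_univ (X := Circ)).exists_bound_of_continuousOn hE.continuousOn
      exact MemLp.of_bound hE.aestronglyMeasurable C (ae_of_all _ fun t => hC t (mem_univ t))
    refine h1.trans ?_
    rw [hm.eLpNorm_eq_integral_rpow_norm (by simpa using hp) (by simp),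
      ENNReal.toReal_ofReal hp.le, ENNReal.ofReal_le_one, ← one_div]
    simp only [norm_mul, Complex.norm_real, Real.norm_of_nonneg hl0]
    simp only [Real.mul_rpow hl0 (norm_nonneg _)]
    rw [integral_const_mul, Real.mul_rpow (by positivity) (integral_nonneg fun t => by positivity),
      ← Real.rpow_mul hl0, mul_one_div_cancel hp.ne', Real.rpow_one]
    exact (mul_le_mul_of_nonneg_left
      (rpow_norm_expSum_dualCoeff_le hpq hψ hg hα hsum hn (by omega)) hl0).trans hl
  have hfmem : f ∈ psiClass ψ β (ENNReal.ofReal p) :=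
    ⟨hfc.integrable_of_hasCompactSupport (HasCompactSupport.of_compactSpace _), φ,
      isPsiBetaDeriv_re_expSum hψ β l hn M, hφ1⟩
  refine le_trans ?_ (le_iSup₂ (f := fun f _ => bestOrth (2 * n) ∞ f) f hfmem)
  refine le_iInf₂ fun γ hγ => ?_
  have hcont : Continuous fun x => (f x : ℂ) - partialSum f γ x := by
    unfold partialSum; fun_prop
  refine le_trans ?_ (enorm_le_eLpNorm_top_of_continuous hcont 0)
  have hcoeff : ∀ k : ℤ, coeff f k
      = ((l / 2 * if k.natAbs ∈ Finset.Icc n M then term ψ q k.natAbs else 0 : ℝ) : ℂ) := by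
    have hnat : ∀ j : ℕ, coeff f j
        = ((l / 2 * if j ∈ Finset.Icc n M then term ψ q j else 0 : ℝ) : ℂ) := by
      intro j
      rw [hf, coeff_re_mul_expSum _ _ hn]
      split_ifs
      · push_cast; ring
      · simp
    intro k
    obtain ⟨j, rfl | rfl⟩ := k.eq_nat_or_neg
    · rw [hnat, Int.natAbs_natCast]
    · rw [coeff_neg, hnat, Int.natAbs_neg, Int.natAbs_natCast, Complex.conj_ofReal]
  have hf0 : f 0 = l * ∑ k ∈ Finset.Icc n M, term ψ q k := by
    have : (l : ℂ) * expSum (term ψ q) n M 0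
        = ((l * ∑ k ∈ Finset.Icc n M, term ψ q k : ℝ) : ℂ) := by
      simp [expSum]
    simp only [hf]
    rw [this, Complex.ofReal_re]
  have hS : partialSum f γ 0 = ((l / 2 * ∑ k ∈ γ,
      if k.natAbs ∈ Finset.Icc n M then term ψ q k.natAbs else 0 : ℝ) : ℂ) := by
    simp only [partialSum, fourier_eval_zero, mul_one, hcoeff]
    rw [Finset.mul_sum, Complex.ofReal_sum]
  have hcard := sum_natAbs_le_of_card (c := term ψ q) hn hM
    (fun k hk => term_nonneg hg (hn.trans hk))
    (fun j k hj hjk => term_antitone hpq hψ hg (hn.trans hj) hjk) hγ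
  have hsplit : ∑ k ∈ Finset.Icc n M, term ψ q k
      = ∑ k ∈ Finset.Ico n (2 * n), term ψ q k + ∑ k ∈ Finset.Icc (2 * n) M, term ψ q k := by
    have e : ∀ m M : ℕ, Finset.Icc m M = Finset.Ico m (M + 1) := fun m M => by ext; simp
    rw [e, e, Finset.sum_Ico_consecutive _ (by omega) (by omega)]
  simp only [hf0, hS]
  rw [← Complex.ofReal_sub, ← ofReal_norm, Complex.norm_real, Real.norm_eq_abs]
  refine ENNReal.ofReal_le_ofReal (le_trans ?_ (le_abs_self _))
  rw [hsplit]
  have := mul_le_mul_of_nonneg_left hcard hl0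
  linarith

/-- The lower bound, the limit of the truncated bounds with the largest admissible normalization. -/
theorem le_bestOrthClass (hpq : p.HolderConjugate q) (hψ : ClassM ψ)
    (hg : ClassM (gFun ψ p)) (hα : q < lowerAlpha (gFun ψ p) 1)
    (hsum : Summable fun j : ℕ => term ψ q (j + 1)) {n : ℕ} (hn : 1 ≤ n) (β : ℝ) :
    ENNReal.ofReal (constLower ψ p q * tailSum ψ q n ^ (1 / q))
      ≤ bestOrthClass (2 * n) ∞ (psiClass ψ β (ENNReal.ofReal p)) := by
  have hpq' : 1 / p + 1 / q = 1 := by simpa using hpq.inv_add_inv_eq_one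
  have hq0 := hpq.symm.pos
  have hxi := xi_pos hpq.lt
  set A := lowerAlpha (gFun ψ p) 1 with hAdef
  have hA : 0 < A := by linarith
  set T := tailSum ψ q n with hTdef
  have hT : 0 < T := by
    refine lt_of_lt_of_le ?_ (sum_Icc_term_le_tailSum hg hsum hn n)
    have := hψ.1 n (show (1 : ℝ) ≤ n by exact_mod_cast hn)
    have hn0 : (0 : ℝ) < n := by exact_mod_cast hn
    simp only [Finset.Icc_self, Finset.sum_singleton, term]
    positivity
  set l := 1 / (xi p * ((1 + q / A) * T) ^ (1 / p)) with hl
  have hl0 : 0 < l := by positivity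
  have hlim := ENNReal.tendsto_ofReal ((tendsto_sum_Icc_term hsum (2 * n)).const_mul l)
  refine le_trans (ENNReal.ofReal_le_ofReal ?_) (le_of_tendsto hlim
    ((eventually_ge_atTop (2 * n)).mono fun M hM =>
      ofReal_mul_sum_term_le hpq hψ hg hα hsum hn hM β hl0.le ?_))
  · have h1 := one_sub_mul_tailSum_le hpq' hpq.symm.lt hg hα hsum hn
    rw [← hAdef, ← hTdef] at h1
    refine le_trans ?_ (mul_le_mul_of_nonneg_left h1 hl0.le)
    have hTp : T = T ^ (1 / p) * T ^ (1 / q) := by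
      rw [← Real.rpow_add hT, hpq', Real.rpow_one]
    have h2 : l * ((1 - q / A) * T)
        = 1 / xi p * (A / (q + A)) ^ (1 / p) * (1 - q / A) * T ^ (1 / q) := by
      have e : A / (q + A) = (1 + q / A)⁻¹ := by field_simp; ring
      rw [hl, Real.mul_rpow (by positivity) hT.le, e, Real.inv_rpow (by positivity)]
      nth_rw 2 [hTp]
      have := Real.rpow_pos_of_pos hT (1 / p)
      field_simp
    rw [h2, constLower, ← hAdef]
    have h3 : 0 ≤ 1 - q / A := by
      rw [sub_nonneg, div_le_one hA]; exact hα.le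
    -- The factor `1 / 3` in the lower constant is not needed.
    gcongr
    linarith
  · rw [hl, one_div_mul_cancel (by positivity)]

end

end OrthTrig

theorem mainTheorem1 (p q : ℝ) (hp : 1 < p) (hpq : 1 / p + 1 / q = 1)
    (ψ : ℝ → ℝ) (hψ : OrthTrig.ClassM ψ)
    (hsum : Summable fun j : ℕ => OrthTrig.term ψ q (j + 1))
    (hg : OrthTrig.ClassM0 (OrthTrig.gFun ψ p))
    (hα : q < OrthTrig.lowerAlpha (OrthTrig.gFun ψ p) 1)
    (n : ℕ) (hn : 1 ≤ n) (β : ℝ) :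
    ENNReal.ofReal (OrthTrig.constLower ψ p q * OrthTrig.tailSum ψ q n ^ (1 / q)) ≤
        OrthTrig.bestOrthClass (2 * n) ∞ (OrthTrig.psiClass ψ β (ENNReal.ofReal p)) ∧
      OrthTrig.bestOrthClass (2 * n) ∞ (OrthTrig.psiClass ψ β (ENNReal.ofReal p)) ≤
        OrthTrig.bestOrthClass (2 * n - 1) ∞ (OrthTrig.psiClass ψ β (ENNReal.ofReal p)) ∧
      OrthTrig.bestOrthClass (2 * n - 1) ∞ (OrthTrig.psiClass ψ β (ENNReal.ofReal p)) ≤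
        ENNReal.ofReal (OrthTrig.constUpper ψ p q * OrthTrig.tailSum ψ q n ^ (1 / q)) := by
  have hconj : p.HolderConjugate q :=
    Real.holderConjugate_iff.2 ⟨hp, by simpa only [one_div] using hpq⟩
  refine ⟨OrthTrig.le_bestOrthClass hconj hψ hg.1 hα hsum hn β, ?_,
    OrthTrig.bestOrthClass_le hconj hψ hg.1 hα hsum hn β⟩
  have h := OrthTrig.bestOrthClass_succ_le hψ β (ENNReal.ofReal p) (2 * n - 1)
  rwa [show 2 * n - 1 + 1 = 2 * n by omega] at h
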